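/- Let $R$ be a Henselian Cohen–Macaulay (Noetherian commutative) local ring with maximal ideal $\mathfrak m$ and residue field $k=R/\mathfrak m$. Assume that $R$ has a canonical module and that $R$ is an isolated singularity, i.e. $R_{\mathfrak p}$ is regular for every prime $\mathfrak p\neq\mathfrak m$. A finitely generated $R$-module $M$ is called maximal Cohen–Macaulay (MCM) if $\mathrm{Ext}^i_R(k,M)=0$ for all $i<\dim R$ (so the zero module is included). Let $\mathcal C$ be the full subcategory of MCM modules in the category of $R$-modules, and let $\widetilde{\mathcal C}$ be the abelian category of contravariant additive functors from $\mathcal C$ to abelian groups. Let $\widehat{\mathcal C}_0\subset\widetilde{\mathcal C}$ be the full subcategory of those $F$ with $F(R)\cong 0$ which are finitely presented, i.e. which fit into an exact sequence $\mathrm{Hom}_{\mathcal C}(-,M)\to \mathrm{Hom}_{\mathcal C}(-,M')\to F\to 0$ with $M,M'\in\mathcal C$. For an indecomposable $M\in\mathcal C$ put $S_M=\mathrm{Hom}_{\mathcal C}(-,M)/\mathrm{rad}(\mathcal C)(-,M)$, where $\mathrm{rad}(\mathcal C)(X,M)$ consists of those $f:X\to M$ such that $fg$ lies in the Jacobson radical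 of $\mathrm{End}_R(M)$ for all $g:M\to X$. Theorem. Suppose $R$ is of finite Cohen–Macaulay type, i.e. there are only finitely many isomorphism classes of indecomposable MCM $R$-modules. Then every functor $F$ in $\widehat{\mathcal C}_0$ admits a finite filtration $$0=F_0\subset F_1\subset\cdots\subset F_{n-1}\subset F_n=F$$ with all $F_i$ in $\widehat{\mathcal C}_0$ such that, for each $i=1,\dots,n$, the quotient $F_i/F_{i-1}$ is simple in $\widetilde{\mathcal C}$ and isomorphic to $S_M$ for some indecomposable MCM module $M\not\cong R$. -/

import Mathlib

open CategoryTheory CategoryTheory.Limits Opposite IsLocalRing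

universe u

/-! ### Additive functors form an abelian category

The instances below, with `Abelian P.FullSubcategory` from Mathlib, make `A ⥤+ B` abelian; kernels
and cokernels are those of the category of all functors, i.e. they are computed pointwise. -/

section AdditiveFunctors

variable {A : Type*} [Category A] [Preadditive A] {B : Type*} [Category B] [Abelian B]

instance additiveFunctor_closedSub :
    (additiveFunctor A B).IsClosedUnderSubobjects where
  prop_of_mono {F G} i _ hG := by
    have : G.Additive := hG
    refine (additiveFunctor_iff F).mpr ⟨fun {X Y f g} => ?_⟩
    rw [← cancel_mono (i.app Y)]
    simp [Functor.map_add]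

instance additiveFunctor_closedQuot :
    (additiveFunctor A B).IsClosedUnderQuotients where
  prop_of_epi {F G} p _ hF := by
    have : F.Additive := hF
    refine (additiveFunctor_iff G).mpr ⟨fun {X Y f g} => ?_⟩
    rw [← cancel_epi (p.app X), ← p.naturality]
    simp [Functor.map_add]

instance additiveFunctor_containsZero : (additiveFunctor A B).ContainsZero where
  exists_zero := by
    obtain ⟨Z, hZ⟩ := HasZeroObject.zero (C := A ⥤ B)
    exact ⟨Z, hZ, (additiveFunctor_iff Z).mpr ⟨fun {_ _ _ _} => (hZ.obj _).eq_of_src _ _⟩⟩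

instance additiveFunctor_closedProducts :
    (additiveFunctor A B).IsClosedUnderFiniteProducts := by
  refine ⟨fun J _ => ⟨?_⟩⟩
  rintro F ⟨h⟩
  have (j : Discrete J) : (h.diag.obj j).Additive := h.prop_diag_obj j
  refine (additiveFunctor_iff F).mpr ⟨fun {X Y f g} => ?_⟩
  apply (isLimitOfPreserves ((evaluation A B).obj Y) h.isLimit).hom_ext
  intro j
  have e (k : X ⟶ Y) := (h.π.app j).naturality k
  simp only [Functor.const_obj_obj] at e
  simp [e, Functor.map_add]

end AdditiveFunctors

/-! ### The radical of a preadditive category, and the functors `S_M` -/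

section Radical

variable {A : Type*} [Category A] [Preadditive A]

/-- The maps `X ⟶ Y` in the Jacobson radical of the category: those `f` such that for all
`g : Y ⟶ X` the composite `Y ⟶ X ⟶ Y` lies in the Jacobson radical of the ring `End Y`. -/
def radHom (X Y : A) : AddSubgroup (X ⟶ Y) where
  carrier := {f | ∀ g : Y ⟶ X, End.of (g ≫ f) ∈ Ring.jacobson (End Y)}
  zero_mem' g := by
    rw [comp_zero]
    exact (Ring.jacobson (End Y)).zero_mem
  add_mem' {a b} ha hb g := by
    rw [Preadditive.comp_add]
    exact (Ring.jacobson (End Y)).add_mem (ha g) (hb g)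
  neg_mem' {a} ha g := by
    rw [Preadditive.comp_neg]
    exact (Ring.jacobson (End Y)).neg_mem (ha g)

lemma radHom_precomp {X X' : A} (Y : A) (f : X' ⟶ X) :
    radHom X Y ≤ (radHom X' Y).comap (Preadditive.leftComp Y f) := fun a ha g => by
  have := ha (g ≫ f)
  rw [Category.assoc] at this
  exact this

end Radical

section Simples

universe v w

variable {A : Type w} [Category.{v} A] [Preadditive A]

/-- The functor `S_M = Hom(-, M) / rad(-, M)`. -/
def simpleFunctor (M : A) : Aᵒᵖ ⥤+ AddCommGrpCat.{v} where
  obj :=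
    { obj := fun N => AddCommGrpCat.of ((N.unop ⟶ M) ⧸ radHom N.unop M)
      map := fun {N N'} f => AddCommGrpCat.ofHom
        (QuotientAddGroup.map _ _ (Preadditive.leftComp M f.unop) (radHom_precomp M f.unop))
      map_id := fun N => by
        ext x
        simp [Preadditive.leftComp]
      map_comp := fun f g => by
        ext x
        simp [Preadditive.leftComp] }
  property := (additiveFunctor_iff _).mpr ⟨fun {N N' f g} => by
    ext x
    simp [Preadditive.leftComp]⟩

/-- The Yoneda embedding `M ↦ Hom(-, M)` into the category of additive functors. -/
def additiveYoneda : A ⥤ (Aᵒᵖ ⥤+ AddCommGrpCat.{v}) :=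
  (additiveFunctor Aᵒᵖ AddCommGrpCat.{v}).lift preadditiveYoneda
    fun M => (additiveFunctor_iff _).mpr (additive_yonedaObj' M)

/-- `F` is finitely presented: there is an exact sequence
`Hom(-, M) ⟶ Hom(-, M') ⟶ F ⟶ 0` of additive functors. -/
def IsFinPresFunctor (F : Aᵒᵖ ⥤+ AddCommGrpCat.{v}) : Prop :=
  ∃ (M M' : A) (g : additiveYoneda.obj M ⟶ additiveYoneda.obj M')
    (p : additiveYoneda.obj M' ⟶ F) (w : g ≫ p = 0),
    (ShortComplex.mk g p w).Exact ∧ Epi p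

end Simples

/-! ### Maximal Cohen-Macaulay modules -/

section MCM

variable (R : Type u) [CommRing R] [IsLocalRing R]

/-- The residue field as an `R`-module. -/
noncomputable abbrev residueModule : ModuleCat.{u} R := ModuleCat.of R (ResidueField R)

/-- A finitely generated module `M` over a local ring `R` with residue field `k` is maximal
Cohen-Macaulay if `Ext^i(k, M) = 0` for all `i < dim R`.  (The zero module is included.) -/
def isMCM : ObjectProperty (ModuleCat.{u} R) := fun M =>
  Module.Finite R M ∧
    ∀ i : ℕ, (i : WithBot ℕ∞) < ringKrullDim R → Subsingleton (Abelian.Ext (residueModule R) M i)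

/-- The category of maximal Cohen-Macaulay modules. -/
abbrev MCMCat : Type (u + 1) := (isMCM R).FullSubcategory

/-- A Noetherian local ring is Cohen-Macaulay if it is maximal Cohen-Macaulay as a module. -/
class IsCMLocalRing [IsNoetherianRing R] : Prop where
  isMCM_self : isMCM R (ModuleCat.of R R)

/-- `R` as an object of the category of maximal Cohen-Macaulay modules. -/
def MCMCat.self [IsNoetherianRing R] [IsCMLocalRing R] : MCMCat R :=
  ⟨ModuleCat.of R R, IsCMLocalRing.isMCM_self⟩

/-- `R` has a canonical module: a maximal Cohen-Macaulay module `ω` of finite injective dimension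
and of type one, i.e. `Ext^d(k, ω)` is one-dimensional over `k`, where `d = dim R`. -/
def HasCanonicalModule : Prop :=
  ∃ ω : ModuleCat.{u} R, isMCM R ω ∧ (∃ n : ℕ, HasInjectiveDimensionLE ω n) ∧
    ∃ d : ℕ, ringKrullDim R = d ∧
      Nonempty (Abelian.Ext (residueModule R) ω d ≃ₗ[R] ResidueField R)

/-- `R` is an isolated singularity: `R_p` is regular for every nonmaximal prime `p`. -/
def IsIsolatedSingularity : Prop :=
  ∀ (p : Ideal R) [p.IsPrime], p ≠ maximalIdeal R → IsRegularLocalRing (Localization.AtPrime p)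

/-- `R` is of finite Cohen-Macaulay type: there are only finitely many isomorphism classes of
indecomposable maximal Cohen-Macaulay modules. -/
def IsFiniteCMType : Prop :=
  {c : Quotient (isIsomorphicSetoid (MCMCat R)) |
    ∃ M : MCMCat R, Indecomposable M.obj ∧ Quotient.mk _ M = c}.Finite

/-- Contravariant additive functors from maximal Cohen-Macaulay modules to abelian groups. -/
abbrev MCMFunctor : Type (u + 1) := (MCMCat R)ᵒᵖ ⥤+ AddCommGrpCat.{u}

variable {R} in
/-- The functor `F` is finitely presented and `F(R) = 0`. -/
def IsFinPresVanishing [IsNoetherianRing R] [IsCMLocalRing R] (F : MCMFunctor R) : Prop :=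
  IsFinPresFunctor F ∧ IsZero (F.obj.obj (op (MCMCat.self R)))

end MCM

/-! Yoneda turns a presentation of `F` into a map `γ : M₁ → M₀` of MCM modules with `F = coker
Hom(-, γ)`. Evaluating at `R` shows that `γ` is surjective. Thus `F(X)` is the module of maps `X →
M₀` modulo those that factor through `γ`.

The heart is that finite type forces `F(X)` to have finite length over `R`. Given `f : X → M₀` and
`r` in the maximal ideal, the pullbacks of `γ` along `r ^ n • f` are MCM, and their numbers of
generators are bounded independently of `n`. Hence, up to isomorphism, only finitely many modules
occur, and infinitely many `n` share one. Miyata's theorem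
(`LinearMap.exists_rightInverse_of_linearEquiv_prod`) makes an exact sequence split when its middle
term is abstractly isomorphic to the sum of the outer ones. Applied to these pullbacks, it shows
that for one fixed `m` the map `r ^ m • f` factors through `γ` modulo arbitrarily high powers of the
maximal ideal. By Krull's intersection theorem it factors exactly (`isMCM.exists_pow_smul_eq_comp`).

Every MCM module is a finite direct sum of the finitely many indecomposables `X i`, so a subfunctor
of `F` is determined by its values there. The subobject lattice of `F` therefore embeds into a
finite product of submodule lattices of finite length modules, and `F` has a composition series.
Finite generation of Hom modules over a Noetherian ring makes all terms finitely presented.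

A simple factor is nonzero on some `X j`. Since `R` is Henselian, `End (X j)` is local, which
identifies the factor with `S_{X j}`. Vanishing at `R` passes to subquotients, so `X j` is not `R`.
-/

/-! ### Henselian rings: lifting coprime factorizations, and units in integral algebras. -/

section Henselian

open Polynomial

/-- An étale algebra over a Henselian local ring which has a point over the closed point with
trivial residue field extension admits a section. -/
theorem HenselianLocalRing.nonempty_algHom_of_etale {R : Type u} [CommRing R]
    [HenselianLocalRing R] {S : Type u} [CommRing S] [Algebra R S] [Algebra.Etale R S]
    (Q : Ideal S) [Q.IsPrime] [Q.LiesOver (maximalIdeal R)]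
    (hQ : Function.Bijective (Ideal.ResidueField.mapₐ (maximalIdeal R) Q (Algebra.ofId R S)
      (Ideal.over_def Q (maximalIdeal R)))) : Nonempty (S →ₐ[R] R) := by
  obtain ⟨f, hfQ, ⟨⟨P⟩⟩⟩ := Algebra.IsEtaleAt.exists_isStandardEtale (R := R) Q
  let φ : Localization.Away f →ₐ[R] Q.ResidueField :=
    IsLocalization.Away.liftAlgHom (f := IsScalarTower.toAlgHom R S Q.ResidueField) f
      (by simpa using hfQ)
  -- The residue extension is trivial, so the image of the standard étale generator comes from some
  -- `a` in `R`. This `a` is a simple root modulo the maximal ideal. Hensel lifts it to a root `b`,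
  -- and sending the generator to `b` is the section.
  obtain ⟨a, ha⟩ : ∃ a : R, algebraMap R Q.ResidueField a = φ P.x := by
    obtain ⟨y, hy⟩ := hQ.2 (φ P.x)
    obtain ⟨a, rfl⟩ := Ideal.algebraMap_residueField_surjective (maximalIdeal R) y
    exact ⟨a, by rw [← hy]; simp⟩
  have hker (b : R) : algebraMap R Q.ResidueField b = 0 ↔ b ∈ maximalIdeal R := by
    rw [IsScalarTower.algebraMap_apply R S, Ideal.algebraMap_residueField_eq_zero,
      Ideal.over_def Q (maximalIdeal R), Ideal.under, Ideal.mem_comap]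
  have heval (p : R[X]) : algebraMap R Q.ResidueField (p.eval a) = φ (aeval P.x p) := by
    rw [← aeval_algHom_apply, ← ha, aeval_algebraMap_apply, coe_aeval_eq_eval]
  obtain ⟨b, hb, hba⟩ := HenselianLocalRing.is_henselian P.f P.monic_f a
    (by rw [← hker, heval, P.hasMap.1, map_zero])
    (by
      rw [← notMem_maximalIdeal, ← hker, heval]
      exact (P.hasMap.isUnit_derivative_f.map φ).ne_zero)
  have hg : P.HasMap b := by
    refine ⟨by simpa using hb, ?_⟩
    rw [coe_aeval_eq_eval, ← notMem_maximalIdeal, ← hker]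
    have : algebraMap R Q.ResidueField b = algebraMap R Q.ResidueField a := by
      rw [← sub_eq_zero, ← map_sub, hker]; exact hba
    have h2 : algebraMap R Q.ResidueField (P.g.eval b) =
        algebraMap R Q.ResidueField (P.g.eval a) := by
      rw [← coe_aeval_eq_eval, ← aeval_algebraMap_apply, this, aeval_algebraMap_apply,
        coe_aeval_eq_eval]
    rw [h2, heval]
    exact (P.hasMap.2.map φ).ne_zero
  exact ⟨((P.lift b hg).comp P.equivRing.toAlgHom).comp (IsScalarTower.toAlgHom R S _)⟩

/-- Coprime factorizations of monic polynomials over the residue field of a Henselian local ring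
lift. -/
theorem HenselianLocalRing.exists_eq_mul {R : Type u} [CommRing R] [HenselianLocalRing R]
    {p : R[X]} (hp : p.Monic) {f g : (maximalIdeal R).ResidueField[X]} (hf : f.Monic) (hg : g.Monic)
    (h : p.map (algebraMap R _) = f * g) (hfg : IsCoprime f g) :
    ∃ f' g' : R[X], f'.Monic ∧ g'.Monic ∧ p = f' * g' ∧ IsCoprime f' g' ∧
      f'.natDegree = f.natDegree ∧ g'.natDegree = g.natDegree := by
  obtain ⟨S, _, _, _, Q, _, _, f', g', hQ, hf', hg', hfg', hc, h1, h2⟩ :=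
    Algebra.exists_etale_bijective_residueFieldMap_and_map_eq_mul_and_isCoprime (maximalIdeal R) p
      f g hp hf hg h hfg
  -- The factorization exists over an étale algebra with trivial residue extension; the section
  -- carries it back to `R`.
  obtain ⟨s⟩ := nonempty_algHom_of_etale Q hQ
  have h3 : f'.natDegree = f.natDegree := by
    rw [← hf'.natDegree_map (algebraMap S Q.ResidueField), ← h1, hf.natDegree_map]
  have h4 : g'.natDegree = g.natDegree := by
    rw [← hg'.natDegree_map (algebraMap S Q.ResidueField), ← h2, hg.natDegree_map]
  have h5 : IsCoprime (f'.map (s : S →+* R)) (g'.map (s : S →+* R)) := by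
    simpa only [Polynomial.coe_mapRingHom] using hc.map (Polynomial.mapRingHom (s : S →+* R))
  have h6 : p = f'.map (s : S →+* R) * g'.map (s : S →+* R) := by
    rw [← Polynomial.map_mul, ← hfg', Polynomial.map_map, AlgHom.comp_algebraMap,
      Algebra.algebraMap_self, Polynomial.map_id]
  exact ⟨_, _, hf'.map _, hg'.map _, h6, h5,
    (hf'.natDegree_map (s : S →+* R)).trans h3, (hg'.natDegree_map (s : S →+* R)).trans h4⟩

/-- An integral element of a possibly noncommutative algebra without nontrivial idempotents over a
Henselian local ring: it or its complement is a unit. -/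
theorem HenselianLocalRing.isUnit_or_isUnit_one_sub {R : Type u} [CommRing R]
    [HenselianLocalRing R] {E : Type*} [Ring E] [Algebra R E]
    (hE : ∀ e : E, IsIdempotentElem e → e = 0 ∨ e = 1) {x : E} (hx : IsIntegral R x) :
    IsUnit x ∨ IsUnit (1 - x) := by
  classical
  have hx' : ∃ n, ∃ p : R[X], p.Monic ∧ aeval x p = 0 ∧ p.natDegree = n := by
    obtain ⟨p, hp, h⟩ := hx
    exact ⟨_, p, hp, h, rfl⟩
  obtain ⟨p, hp, hpx, hn⟩ := Nat.find_spec hx'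
  have hmin (q : R[X]) (hq : q.Monic) (hqx : aeval x q = 0) : p.natDegree ≤ q.natDegree :=
    hn ▸ Nat.find_min' hx' ⟨q, hq, hqx, rfl⟩
  -- Evaluating `p - p(a) = (X - a) q` at `x` gives `-p(a) = (x - a) q(x)`.
  have hunit (a : R) (ha : IsUnit (p.eval a)) : IsUnit (x - algebraMap R E a) := by
    obtain ⟨q, hq⟩ := X_sub_C_dvd_sub_C_eval (p := p) (a := a)
    obtain ⟨u, hu⟩ := ha
    have h := congr(aeval x $hq)
    have h' := congr(aeval x $(hq.trans (mul_comm _ _)))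
    simp only [map_sub, hpx, aeval_C, map_mul, aeval_X, zero_sub] at h h'
    rw [← hu] at h h'
    have hv : algebraMap R E u * algebraMap R E (↑u⁻¹ : R) = 1 := by
      rw [← map_mul, Units.mul_inv, map_one]
    refine isUnit_iff_exists.mpr ⟨-(aeval x q * algebraMap R E (↑u⁻¹ : R)), ?_, ?_⟩
    · rw [mul_neg, ← mul_assoc, ← h, neg_mul, neg_neg, hv]
    · rw [(Algebra.commutes _ _).symm, neg_mul, mul_assoc, ← h', mul_neg, neg_neg,
        ← Algebra.commutes, hv]
  by_cases h0 : IsUnit (p.eval 0)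
  · left; simpa using hunit 0 h0
  · right
    -- Split off the full power of `X` modulo the maximal ideal and lift to `p = f' g'` with `u f' +
    -- v g' = 1`. Then `(u f')(x)` is idempotent. If it is `0`, then `f'(x) = 0`, and minimality of
    -- the degree of `p` leaves no other factor. If it is `1`, then `g'(x) = 0`, which contradicts
    -- minimality because `n ≠ 0`.
    have key : p.map (algebraMap R (maximalIdeal R).ResidueField) = X ^ p.natDegree := by
      obtain ⟨q, hq, hq'⟩ := (p.map (algebraMap R (maximalIdeal R).ResidueField)).exists_eq_pow_rootMultiplicity_mul_and_not_dvd
        (hp.map _).ne_zero 0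
      rw [C_0, sub_zero] at hq hq'
      set n := (p.map (algebraMap R (maximalIdeal R).ResidueField)).rootMultiplicity 0 with hn'
      have hqm : q.Monic := (monic_X_pow n).of_mul_monic_left (hq ▸ hp.map _)
      have hcop : IsCoprime (X ^ n) q :=
        ((irreducible_X (R := (maximalIdeal R).ResidueField)).coprime_iff_not_dvd.mpr hq').pow_left
      obtain ⟨f', g', hf', hg', hfg, ⟨u, v, huv⟩, hfn, hgn⟩ :=
        exists_eq_mul hp (monic_X_pow n) hqm hq hcop
      have hdeg : p.natDegree = n + q.natDegree := by
        rw [hfg, hf'.natDegree_mul hg', hfn, hgn, natDegree_X_pow]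
      have hn0 : n ≠ 0 := by
        intro h
        apply h0
        rw [← notMem_maximalIdeal, ← Ideal.algebraMap_residueField_eq_zero]
        intro h0'
        rw [h, pow_zero, one_mul] at hq
        rw [← hq, X_dvd_iff, coeff_map, coeff_zero_eq_eval_zero] at hq'
        exact hq' h0'
      have hsum : aeval x u * aeval x f' + aeval x v * aeval x g' = 1 := by
        rw [← map_mul, ← map_mul, ← map_add, huv, map_one]
      have hprod : aeval x f' * aeval x g' = 0 := by rw [← map_mul, ← hfg, hpx]
      have hidem : IsIdempotentElem (aeval x (u * f')) := by
        have : aeval x (u * f') * (aeval x (u * f') - 1) = 0 := by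
          rw [← map_one (aeval (R := R) x), ← map_sub, ← map_mul, ← huv,
            show u * f' * (u * f' - (u * f' + v * g')) = -(u * v) * (f' * g') by ring, ← hfg,
            map_mul, hpx, mul_zero]
        rw [mul_sub, mul_one, sub_eq_zero] at this
        exact this
      rcases hE _ hidem with h | h
      · have h1 : aeval x f' = 0 := by
          rw [← mul_one (aeval x f'), ← hsum, ← map_mul, h, zero_add, ← map_mul, ← map_mul,
            show f' * (v * g') = v * (f' * g') by ring, map_mul, map_mul, hprod, mul_zero]
        have := hmin f' hf' h1
        rw [hfn, natDegree_X_pow, hdeg] at this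
        have hq1 : q = 1 := hqm.natDegree_eq_zero.mp (by omega)
        rw [hdeg, hq, hq1, mul_one, natDegree_one, add_zero]
      · exfalso
        have h1 : aeval x g' = 0 := by
          have h2 : aeval x g' = aeval x g' * aeval x (u * f') := by rw [h, mul_one]
          rw [h2, ← map_mul, show g' * (u * f') = u * (f' * g') by ring, map_mul, map_mul, hprod,
            mul_zero]
        have := hmin g' hg' h1
        rw [hgn, hdeg] at this
        omega
    have h1 : IsUnit (p.eval 1) := by
      rw [← notMem_maximalIdeal, ← Ideal.algebraMap_residueField_eq_zero]
      have : algebraMap R (maximalIdeal R).ResidueField (p.eval 1) = (p.map (algebraMap R (maximalIdeal R).ResidueField)).eval 1 := by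
        rw [Polynomial.eval_map, ← eval₂_at_apply, map_one]
      rw [this, key]
      simp
    have := (hunit 1 h1).neg
    simpa using this

end Henselian

/-! ### Finite modules killed by powers of the maximal ideal. -/

section FiniteLength

variable {R : Type*} [CommRing R] [IsLocalRing R] [IsNoetherianRing R]

theorem IsLocalRing.isArtinianRing_quotient_maximalIdeal_pow (k : ℕ) :
    IsArtinianRing (R ⧸ maximalIdeal R ^ k) := by
  rw [isArtinianRing_iff_isNoetherianRing_krullDimLE_zero]
  refine ⟨inferInstance, Ring.krullDimLE_zero_iff.mpr fun q hq => ?_⟩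
  have h1 : maximalIdeal R ≤ q.comap (Ideal.Quotient.mk (maximalIdeal R ^ k)) :=
    Ideal.IsPrime.le_of_pow_le (n := k) (by
      rw [← Ideal.map_le_iff_le_comap, Ideal.map_quotient_self]
      exact bot_le)
  have h2 := (maximalIdeal.isMaximal R).eq_of_le (Ideal.IsPrime.ne_top inferInstance) h1
  have h3 : (q.comap (Ideal.Quotient.mk (maximalIdeal R ^ k))).IsMaximal := h2 ▸ inferInstance
  have h4 := (Ideal.map_eq_top_or_isMaximal_of_surjective (Ideal.Quotient.mk (maximalIdeal R ^ k))
    Ideal.Quotient.mk_surjective h3)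
  rw [Ideal.map_comap_of_surjective _ Ideal.Quotient.mk_surjective] at h4
  exact h4.resolve_left hq.ne_top

theorem IsLocalRing.isArtinian_of_pow_le_annihilator {M : Type*} [AddCommGroup M] [Module R M]
    [Module.Finite R M] (k : ℕ) (h : maximalIdeal R ^ k ≤ Module.annihilator R M) :
    IsArtinian R M := by
  have ht : Module.IsTorsionBySet R M (maximalIdeal R ^ k : Ideal R) := fun x r =>
    Module.mem_annihilator.mp (h r.2) x
  let := ht.module
  have : IsScalarTower R (R ⧸ maximalIdeal R ^ k) M := ht.isScalarTower
  have := isArtinianRing_quotient_maximalIdeal_pow (R := R) k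
  have : Module.Finite (R ⧸ maximalIdeal R ^ k) M := Module.Finite.of_restrictScalars_finite R _ _
  exact isArtinian_of_surjective_algebraMap (R := R ⧸ maximalIdeal R ^ k)
    Ideal.Quotient.mk_surjective

/-- Finitely many generators give one exponent for each `r`, so the maximal ideal lies in the
radical of the annihilator. Being finitely generated, it has a power inside the annihilator. -/
theorem IsLocalRing.isArtinian_of_forall_exists_pow_smul_eq_zero {M : Type*} [AddCommGroup M]
    [Module R M] [Module.Finite R M]
    (h : ∀ r ∈ maximalIdeal R, ∀ x : M, ∃ n : ℕ, r ^ n • x = 0) : IsArtinian R M := by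
  have hrad : maximalIdeal R ≤ (Module.annihilator R M).radical := by
    intro r hr
    obtain ⟨s, hs⟩ := Module.Finite.fg_top (R := R) (M := M)
    choose n hn using h r hr
    refine ⟨s.sup n, Module.mem_annihilator.mpr fun x => ?_⟩
    have hx : x ∈ Submodule.span R (s : Set M) := hs ▸ Submodule.mem_top
    induction hx using Submodule.span_induction with
    | mem x hx =>
      rw [← Nat.sub_add_cancel (Finset.le_sup (f := n) hx), pow_add, mul_smul, hn, smul_zero]
    | zero => exact smul_zero _
    | add x y _ _ hx hy => rw [smul_add, hx, hy, add_zero]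
    | smul a x _ hx => rw [smul_comm, hx, smul_zero]
  obtain ⟨k, hk⟩ := Ideal.exists_pow_le_of_le_radical_of_fg hrad
    (IsNoetherian.noetherian (maximalIdeal R))
  exact isArtinian_of_pow_le_annihilator k hk

end FiniteLength

/-! ### Miyata's splitting theorem by counting lengths. -/

section Miyata

variable {R : Type*} [CommRing R] {F G : Type*} [AddCommGroup F] [Module R F] [AddCommGroup G]
  [Module R G]

/-- The image of `Hom(G, V) → Hom(F, V)` together with `I • Hom(F, V)`. -/
def precompSup (ρ : F →ₗ[R] G) (I : Ideal R) (V : Type*) [AddCommGroup V] [Module R V] :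
    Submodule R (F →ₗ[R] V) :=
  LinearMap.range (LinearMap.lcomp R V ρ) ⊔ I • ⊤

variable {A B C : Type*} [AddCommGroup A] [Module R A] [AddCommGroup B] [Module R B]
  [AddCommGroup C] [Module R C]

lemma precompSup_le_comap (ρ : F →ₗ[R] G) (I : Ideal R) (i : A →ₗ[R] B) :
    precompSup ρ I A ≤ (precompSup ρ I B).comap (i.compRight R) := by
  refine sup_le ?_ ?_
  · rintro _ ⟨x, rfl⟩
    exact Submodule.mem_sup_left ⟨i ∘ₗ x, rfl⟩
  · rw [← Submodule.map_le_iff_le_comap, Submodule.map_smul'']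
    exact le_sup_of_le_right (Submodule.smul_mono le_rfl le_top)

/-- `V ↦ Hom(F, V) ⧸ precompSup ρ I V` on maps. -/
def precompSupMap (ρ : F →ₗ[R] G) (I : Ideal R) (i : A →ₗ[R] B) :
    ((F →ₗ[R] A) ⧸ precompSup ρ I A) →ₗ[R] ((F →ₗ[R] B) ⧸ precompSup ρ I B) :=
  Submodule.mapQ _ _ (i.compRight R) (precompSup_le_comap ρ I i)

lemma precompSupMap_comp (ρ : F →ₗ[R] G) (I : Ideal R) (i : A →ₗ[R] B) (j : B →ₗ[R] C) :
    precompSupMap ρ I (j ∘ₗ i) = precompSupMap ρ I j ∘ₗ precompSupMap ρ I i := by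
  refine Submodule.linearMap_qext _ (LinearMap.ext fun x => ?_)
  rfl

lemma precompSupMap_id (ρ : F →ₗ[R] G) (I : Ideal R) :
    precompSupMap ρ I (LinearMap.id : A →ₗ[R] A) = LinearMap.id := by
  refine Submodule.linearMap_qext _ (LinearMap.ext fun x => ?_)
  rfl

variable [Module.Projective R F]

lemma precompSupMap_surjective (ρ : F →ₗ[R] G) (I : Ideal R) (p : B →ₗ[R] C)
    (hp : Function.Surjective p) : Function.Surjective (precompSupMap ρ I p) := by
  intro x
  obtain ⟨x, rfl⟩ := Submodule.Quotient.mk_surjective _ x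
  obtain ⟨y, rfl⟩ := Module.projective_lifting_property p x hp
  exact ⟨Submodule.Quotient.mk y, rfl⟩

/-- For finite free `F` and `G`, this functor is tensoring with `coker(ρ^*) ⊗ R/I`, hence right
exact. The proof lifts maps out of the projectives `F` and `G` directly. -/
lemma precompSupMap_exact [Module.Projective R G] (ρ : F →ₗ[R] G) (I : Ideal R) (i : A →ₗ[R] B) (p : B →ₗ[R] C)
    (hp : Function.Surjective p) (h : Function.Exact i p) :
    Function.Exact (precompSupMap ρ I i) (precompSupMap ρ I p) := by
  have hsurj : Function.Surjective (LinearMap.compRight R p : (F →ₗ[R] B) →ₗ[R] _) := fun x =>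
    Module.projective_lifting_property p x hp
  refine LinearMap.exact_of_comp_eq_zero_of_ker_le_range ?_ ?_
  · rw [← precompSupMap_comp, h.linearMap_comp_eq_zero]
    refine Submodule.linearMap_qext _ (LinearMap.ext fun x => ?_)
    exact (Submodule.Quotient.mk_eq_zero _).mpr (by simp)
  · intro x hx
    obtain ⟨x, rfl⟩ := Submodule.Quotient.mk_surjective _ x
    have hx : p ∘ₗ x ∈ precompSup ρ I C := (Submodule.Quotient.mk_eq_zero _).mp hx
    obtain ⟨_, ⟨c, rfl⟩, d, hd, hcd⟩ := Submodule.mem_sup.mp hx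
    obtain ⟨b, rfl⟩ := Module.projective_lifting_property p c hp
    have hd' : d ∈ (I • ⊤ : Submodule R (F →ₗ[R] B)).map (LinearMap.compRight R p) := by
      rwa [Submodule.map_smul'', Submodule.map_top, LinearMap.range_eq_top.mpr hsurj]
    obtain ⟨e, he, rfl⟩ := hd'
    have hz : p ∘ₗ (x - b ∘ₗ ρ - e) = 0 := by
      rw [LinearMap.comp_sub, LinearMap.comp_sub, ← hcd]
      ext; simp
    obtain ⟨a, ha⟩ : ∃ a : F →ₗ[R] A, i ∘ₗ a = x - b ∘ₗ ρ - e := by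
      obtain ⟨a, ha⟩ := Module.projective_lifting_property i.rangeRestrict
        ((x - b ∘ₗ ρ - e).codRestrict (LinearMap.range i)
          (fun v => (h _).mp (LinearMap.congr_fun hz v))) i.surjective_rangeRestrict
      exact ⟨a, LinearMap.ext fun v => congrArg Subtype.val (LinearMap.congr_fun ha v)⟩
    refine ⟨Submodule.Quotient.mk a, ?_⟩
    change Submodule.Quotient.mk (i ∘ₗ a) = _
    rw [ha, Submodule.Quotient.eq]
    have : x - b ∘ₗ ρ - e - x = -(b ∘ₗ ρ + e) := by abel
    rw [this, neg_mem_iff]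
    exact add_mem (Submodule.mem_sup_left ⟨b, rfl⟩) (Submodule.mem_sup_right he)

end Miyata

section Miyata'

variable {R : Type*} [CommRing R] [IsLocalRing R] [IsNoetherianRing R]
  {A B C : Type*} [AddCommGroup A] [Module R A] [AddCommGroup B] [Module R B]
  [AddCommGroup C] [Module R C] [Module.Finite R A] [Module.Finite R C]

/-- All values have finite length. The isomorphism makes the length at `B` the sum of those at `A`
and `C`, so by right exactness the image of the value at `A` has full length and the kernel has
length zero. -/
lemma precompSupMap_injective_of_linearEquiv {m n : ℕ} (ρ : (Fin m → R) →ₗ[R] (Fin n → R))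
    (k : ℕ) (i : A →ₗ[R] B) (p : B →ₗ[R] C) (hp : Function.Surjective p)
    (h : Function.Exact i p) (e : B ≃ₗ[R] A × C) :
    Function.Injective (precompSupMap ρ (maximalIdeal R ^ k) i) := by
  set I := maximalIdeal R ^ k
  have : Module.Finite R B := Module.Finite.equiv e.symm
  have hA : IsArtinian R (((Fin m → R) →ₗ[R] A) ⧸ precompSup ρ I A) := by
    refine isArtinian_of_pow_le_annihilator k fun r hr => Module.mem_annihilator.mpr fun x => ?_
    obtain ⟨x, rfl⟩ := Submodule.Quotient.mk_surjective _ x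
    rw [← Submodule.Quotient.mk_smul, Submodule.Quotient.mk_eq_zero]
    exact Submodule.mem_sup_right (Submodule.smul_mem_smul hr Submodule.mem_top)
  have hC : IsArtinian R (((Fin m → R) →ₗ[R] C) ⧸ precompSup ρ I C) := by
    refine isArtinian_of_pow_le_annihilator k fun r hr => Module.mem_annihilator.mpr fun x => ?_
    obtain ⟨x, rfl⟩ := Submodule.Quotient.mk_surjective _ x
    rw [← Submodule.Quotient.mk_smul, Submodule.Quotient.mk_eq_zero]
    exact Submodule.mem_sup_right (Submodule.smul_mem_smul hr Submodule.mem_top)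
  have e' : (((Fin m → R) →ₗ[R] B) ⧸ precompSup ρ I B) ≃ₗ[R]
      (((Fin m → R) →ₗ[R] (A × C)) ⧸ precompSup ρ I (A × C)) :=
    LinearEquiv.ofLinearMap (precompSupMap ρ I e.toLinearMap) (precompSupMap ρ I e.symm.toLinearMap)
      (by rw [← precompSupMap_comp, e.comp_symm, precompSupMap_id])
      (by rw [← precompSupMap_comp, e.symm_comp, precompSupMap_id])
  have hinl : Function.Injective (precompSupMap ρ I (LinearMap.inl R A C)) := by
    refine Function.LeftInverse.injective (g := precompSupMap ρ I (LinearMap.fst R A C)) fun x => ?_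
    rw [← LinearMap.comp_apply, ← precompSupMap_comp, LinearMap.fst_comp_inl, precompSupMap_id,
      LinearMap.id_apply]
  have h1 := Module.length_eq_add_of_exact _ _ hinl
    (precompSupMap_surjective ρ I _ LinearMap.snd_surjective)
    (precompSupMap_exact ρ I _ _ LinearMap.snd_surjective .inl_snd)
  have h2 := Module.length_eq_add_of_exact (LinearMap.range (precompSupMap ρ I i)).subtype
    (precompSupMap ρ I p) (Submodule.subtype_injective _)
    (precompSupMap_surjective ρ I _ hp)
    (by
      rw [LinearMap.exact_iff, Submodule.range_subtype, (precompSupMap_exact ρ I i p hp h).linearMap_ker_eq])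
  have h3 := Module.length_eq_add_of_exact (LinearMap.ker (precompSupMap ρ I i)).subtype
    (precompSupMap ρ I i).rangeRestrict (Submodule.subtype_injective _)
    (LinearMap.surjective_rangeRestrict _)
    (by rw [LinearMap.exact_iff, Submodule.range_subtype, LinearMap.ker_rangeRestrict])
  rw [← e'.length_eq, h2] at h1
  have hCne := Module.length_ne_top (R := R) (M := ((Fin m → R) →ₗ[R] C) ⧸ precompSup ρ I C)
  have hAne := Module.length_ne_top (R := R) (M := ((Fin m → R) →ₗ[R] A) ⧸ precompSup ρ I A)
  have h4 := WithTop.add_right_cancel hCne h1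
  rw [h4] at h3
  have h5 : Module.length R (LinearMap.ker (precompSupMap ρ I i)) = 0 := by
    exact WithTop.add_right_cancel hAne (h3.symm.trans (zero_add _).symm)
  rw [Module.length_eq_zero_iff, Submodule.subsingleton_iff_eq_bot] at h5
  exact LinearMap.ker_eq_bot.mp h5

/-- Miyata's theorem: an exact sequence `A → B → C → 0` with `B ≅ A × C` splits. -/
theorem LinearMap.exists_rightInverse_of_linearEquiv_prod (i : A →ₗ[R] B) (p : B →ₗ[R] C)
    (hp : Function.Surjective p) (h : Function.Exact i p)
    (e : B ≃ₗ[R] A × C) : ∃ s : C →ₗ[R] B, p ∘ₗ s = LinearMap.id := by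
  obtain ⟨n, π, hπ⟩ := Module.Finite.exists_fin' R C
  obtain ⟨m, ρ', hρ'⟩ := Module.Finite.exists_fin' R (LinearMap.ker π)
  let ρ : (Fin m → R) →ₗ[R] (Fin n → R) := (LinearMap.ker π).subtype ∘ₗ ρ'
  have hπρ : π ∘ₗ ρ = 0 := LinearMap.ext fun v => (ρ' v).2
  -- The lift `y` of `π` sends the relations of `C` into the image of `i`, which yields `z`. If `z`
  -- extends along `ρ` to some `x`, then `y - i ∘ x` kills the relations and descends to a section.
  obtain ⟨y, hy⟩ := Module.projective_lifting_property p π hp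
  obtain ⟨z, hz⟩ : ∃ z : (Fin m → R) →ₗ[R] A, i ∘ₗ z = y ∘ₗ ρ := by
    have hv (v) : p ((y ∘ₗ ρ) v) = 0 := by
      rw [← LinearMap.comp_apply, ← LinearMap.comp_assoc, hy, hπρ, LinearMap.zero_apply]
    obtain ⟨a, ha⟩ := Module.projective_lifting_property i.rangeRestrict
      ((y ∘ₗ ρ).codRestrict (LinearMap.range i) (fun v => (h _).mp (hv v)))
      i.surjective_rangeRestrict
    exact ⟨a, LinearMap.ext fun v => congrArg Subtype.val (LinearMap.congr_fun ha v)⟩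
  -- The class of `z` dies in the quotient for `B`, since `i ∘ z = y ∘ ρ`; injectivity brings this
  -- back to `A`. Krull's intersection theorem then removes the power of the maximal ideal.
  have hk (k : ℕ) : z ∈ precompSup ρ (maximalIdeal R ^ k) A := by
    rw [← Submodule.Quotient.mk_eq_zero]
    apply precompSupMap_injective_of_linearEquiv ρ k i p hp h e
    rw [map_zero]
    refine (Submodule.Quotient.mk_eq_zero _).mpr ?_
    change i ∘ₗ z ∈ _
    rw [hz]
    exact Submodule.mem_sup_left ⟨y, rfl⟩
  obtain ⟨x, hx⟩ : z ∈ LinearMap.range (LinearMap.lcomp R A ρ) := by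
    rw [← Submodule.Quotient.mk_eq_zero, ← Submodule.mem_bot R,
      ← Ideal.iInf_pow_smul_eq_bot_of_isLocalRing (maximalIdeal R) (Ideal.IsPrime.ne_top inferInstance),
      Submodule.mem_iInf]
    intro k
    obtain ⟨a, ha, b, hb, hab⟩ := Submodule.mem_sup.mp (hk k)
    rw [← hab, Submodule.Quotient.mk_add, (Submodule.Quotient.mk_eq_zero _).mpr ha, zero_add]
    have := Submodule.mem_map_of_mem (f := Submodule.mkQ (LinearMap.range (LinearMap.lcomp R A ρ))) hb
    rw [Submodule.map_smul''] at this
    exact Submodule.smul_mono le_rfl le_top this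
  have hker : LinearMap.ker π ≤ LinearMap.ker (y - i ∘ₗ x) := by
    intro v hv
    obtain ⟨w, hw⟩ := hρ' ⟨v, hv⟩
    have hw' : ρ w = v := congrArg Subtype.val hw
    rw [LinearMap.mem_ker, ← hw', LinearMap.sub_apply, sub_eq_zero, ← LinearMap.comp_apply, ← hz,
      ← hx]
    rfl
  let s := (LinearMap.ker π).liftQ (y - i ∘ₗ x) hker ∘ₗ
    (π.quotKerEquivOfSurjective hπ).symm.toLinearMap
  refine ⟨s, LinearMap.ext fun c => ?_⟩
  obtain ⟨v, rfl⟩ := hπ c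
  have : s (π v) = y v - i (x v) := by
    have : (π.quotKerEquivOfSurjective hπ).symm (π v) = Submodule.Quotient.mk v := by
      rw [LinearEquiv.symm_apply_eq]; rfl
    simp [s, this]
  rw [LinearMap.comp_apply, this, map_sub, h.apply_apply_eq_zero, sub_zero, LinearMap.id_apply, ← hy]
  rfl

end Miyata'

/-! ### Isomorphic pullbacks force divisibility modulo maps that factor through `γ`. -/

section Torsion

variable {R : Type*} [CommRing R]
  {M₀ M₁ X : Type*} [AddCommGroup M₀] [Module R M₀] [AddCommGroup M₁] [Module R M₁]
  [AddCommGroup X] [Module R X]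

/-- The pullback of `γ : M₁ → M₀` and `f : X → M₀`. -/
abbrev linearPullback (γ : M₁ →ₗ[R] M₀) (f : X →ₗ[R] M₀) : Submodule R (M₁ × X) :=
  LinearMap.ker (γ ∘ₗ LinearMap.fst R M₁ X - f ∘ₗ LinearMap.snd R M₁ X)

lemma mem_linearPullback {γ : M₁ →ₗ[R] M₀} {f : X →ₗ[R] M₀} {x : M₁ × X} :
    x ∈ linearPullback γ f ↔ γ x.1 = f x.2 := by
  simp [sub_eq_zero]

variable [IsLocalRing R] [IsNoetherianRing R] [Module.Finite R M₁] [Module.Finite R X]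

/-- If `f : X → M₀` and `s • f` have isomorphic pullbacks along a surjection `γ`, then `f` is
divisible by `s` modulo the maps factoring through `γ`. -/
lemma exists_eq_comp_add_smul_of_linearPullback_equiv {γ : M₁ →ₗ[R] M₀}
    (hγ : Function.Surjective γ) (f : X →ₗ[R] M₀) (s : R)
    (e : linearPullback γ f ≃ₗ[R] linearPullback γ (s • f)) :
    ∃ (h : X →ₗ[R] M₁) (t : X →ₗ[R] X), f = γ ∘ₗ h + s • (f ∘ₗ t) := by
  let pr : linearPullback γ f →ₗ[R] X := LinearMap.snd R M₁ X ∘ₗ Submodule.subtype _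
  -- The pullback along `s • f` is the pullback of `linearPullback γ f → X` along multiplication by
  -- `s`. This gives the exact sequence with `i (a, x) = ((a, s x), x)` and `p ((a, y), x) = y - s
  -- x`, whose middle term is abstractly the product of the outer ones.
  let i : linearPullback γ (s • f) →ₗ[R] linearPullback γ f × X :=
    LinearMap.prod
      (LinearMap.codRestrict _ ((LinearMap.prodMap LinearMap.id (s • LinearMap.id)) ∘ₗ
        Submodule.subtype _) (fun x => by
          have := mem_linearPullback.mp x.2
          rw [mem_linearPullback]
          simpa using this))
      (LinearMap.snd R M₁ X ∘ₗ Submodule.subtype _)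
  let p : linearPullback γ f × X →ₗ[R] X := LinearMap.coprod pr (-(s • LinearMap.id))
  have hp : Function.Surjective p := by
    intro x
    obtain ⟨a, ha⟩ := hγ (f x)
    exact ⟨(⟨(a, x), mem_linearPullback.mpr ha⟩, 0), by simp [p, pr]⟩
  have hex : Function.Exact i p := by
    rintro ⟨⟨⟨a, y⟩, h⟩, x⟩
    rw [mem_linearPullback] at h
    constructor
    · intro h0
      have hy : y = s • x := by simpa [p, pr, ← sub_eq_add_neg, sub_eq_zero] using h0
      subst hy
      refine ⟨⟨(a, x), mem_linearPullback.mpr (by simpa using h)⟩, ?_⟩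
      rfl
    · rintro ⟨⟨⟨a', x'⟩, h'⟩, h0⟩
      rw [← h0]
      simp [i, p, pr]
  obtain ⟨σ, hσ⟩ := LinearMap.exists_rightInverse_of_linearEquiv_prod i p hp hex
    (e.prodCongr (LinearEquiv.refl R X))
  refine ⟨LinearMap.fst R M₁ X ∘ₗ Submodule.subtype _ ∘ₗ LinearMap.fst R _ X ∘ₗ σ,
    -(LinearMap.snd R _ X ∘ₗ σ), LinearMap.ext fun x => ?_⟩
  have h1 := LinearMap.congr_fun hσ x
  have h2 := mem_linearPullback.mp (σ x).1.2
  have h3 : x = (σ x).1.1.2 - s • (σ x).2 := by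
    simpa [p, pr, ← sub_eq_add_neg] using h1.symm
  change f x = γ (σ x).1.1.1 + s • f (-(σ x).2)
  rw [h2, ← map_smul, ← map_add, smul_neg, ← sub_eq_add_neg, ← h3]

/-- For `m` and `n ≥ m + k` in `S`, the previous lemma with `s = r ^ (n - m)` writes `r ^ m • f` as
a map through `γ` plus a multiple of `r ^ (n - m)`. As `k` is arbitrary, Krull's intersection
theorem applies. -/
theorem exists_pow_smul_eq_comp {γ : M₁ →ₗ[R] M₀} (hγ : Function.Surjective γ) [Module.Finite R M₀]
    (f : X →ₗ[R] M₀) {r : R} (hr : r ∈ maximalIdeal R) {S : Set ℕ} (hS : S.Infinite)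
    (h : ∀ m ∈ S, ∀ n ∈ S,
      Nonempty (linearPullback γ (r ^ m • f) ≃ₗ[R] linearPullback γ (r ^ n • f))) :
    ∃ (n : ℕ) (g : X →ₗ[R] M₁), r ^ n • f = γ ∘ₗ g := by
  obtain ⟨m, hm⟩ := hS.nonempty
  suffices r ^ m • f ∈ LinearMap.range (LinearMap.compRight R γ : (X →ₗ[R] M₁) →ₗ[R] _) by
    obtain ⟨g, hg⟩ := this
    exact ⟨m, g, hg.symm⟩
  rw [← Submodule.Quotient.mk_eq_zero, ← Submodule.mem_bot R,
    ← Ideal.iInf_pow_smul_eq_bot_of_isLocalRing (maximalIdeal R)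
      (Ideal.IsPrime.ne_top inferInstance), Submodule.mem_iInf]
  intro k
  obtain ⟨n, hn, hmn⟩ := hS.exists_gt (m + k)
  obtain ⟨d, rfl⟩ : ∃ d, n = d + m := ⟨n - m, by omega⟩
  obtain ⟨e⟩ := h m hm _ hn
  rw [pow_add, mul_smul] at e
  obtain ⟨g, t, hgt⟩ := exists_eq_comp_add_smul_of_linearPullback_equiv hγ _ _ e
  have hg : γ ∘ₗ g ∈ LinearMap.range (LinearMap.compRight R γ : (X →ₗ[R] M₁) →ₗ[R] _) := ⟨g, rfl⟩
  rw [hgt, Submodule.Quotient.mk_add, (Submodule.Quotient.mk_eq_zero _).mpr hg, zero_add,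
    Submodule.Quotient.mk_smul]
  exact Submodule.smul_mem_smul (Ideal.pow_le_pow_right (by omega) (Ideal.pow_mem_pow hr d))
    Submodule.mem_top

end Torsion

/-! ### Closure properties of maximal Cohen–Macaulay modules. -/

section MCMClosure

open Abelian

variable {R : Type u} [CommRing R] [IsLocalRing R]

lemma isMCM.of_retract {M N : ModuleCat.{u} R} (hM : isMCM R M) (i : N ⟶ M) (p : M ⟶ N)
    (h : i ≫ p = 𝟙 N) : isMCM R N := by
  refine ⟨?_, fun n hn => ⟨fun x y => ?_⟩⟩
  · have := hM.1
    refine Module.Finite.of_surjective p.hom fun x => ⟨i.hom x, ?_⟩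
    exact congr($h x)
  · have := hM.2 n hn
    have key (z : Ext (residueModule R) N n) : z = (z.comp (Ext.mk₀ i) (add_zero n)).comp
        (Ext.mk₀ p) (add_zero n) := by
      rw [Ext.comp_assoc_of_third_deg_zero, Ext.mk₀_comp_mk₀, h, Ext.comp_mk₀_id]
    rw [key x, key y, Subsingleton.elim (x.comp (Ext.mk₀ i) (add_zero n))]

lemma isMCM.prod {M N : ModuleCat.{u} R} (hM : isMCM R M) (hN : isMCM R N) :
    isMCM R (ModuleCat.of R (M × N)) := by
  have := hM.1
  have := hN.1
  refine ⟨inferInstanceAs (Module.Finite R (M × N)), fun n hn => ⟨fun x y => ?_⟩⟩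
  have := hM.2 n hn
  have := hN.2 n hn
  have h : 𝟙 (ModuleCat.of R (M × N)) =
      ModuleCat.ofHom (LinearMap.fst R M N) ≫ ModuleCat.ofHom (LinearMap.inl R M N) +
      ModuleCat.ofHom (LinearMap.snd R M N) ≫ ModuleCat.ofHom (LinearMap.inr R M N) := by
    ext x <;> simp
  have key (z : Ext (residueModule R) (ModuleCat.of R (M × N)) n) :
      z = (z.comp (Ext.mk₀ (ModuleCat.ofHom (LinearMap.fst R M N))) (add_zero n)).comp
        (Ext.mk₀ (ModuleCat.ofHom (LinearMap.inl R M N))) (add_zero n) +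
        (z.comp (Ext.mk₀ (ModuleCat.ofHom (LinearMap.snd R M N))) (add_zero n)).comp
        (Ext.mk₀ (ModuleCat.ofHom (LinearMap.inr R M N))) (add_zero n) := by
    rw [Ext.comp_assoc_of_third_deg_zero, Ext.mk₀_comp_mk₀, Ext.comp_assoc_of_third_deg_zero,
      Ext.mk₀_comp_mk₀, ← Ext.comp_add, ← Ext.mk₀_add, ← h, Ext.comp_mk₀_id]
  rw [key x, key y, Subsingleton.elim (x.comp (Ext.mk₀ (ModuleCat.ofHom (LinearMap.fst R M N))) _),
    Subsingleton.elim (x.comp (Ext.mk₀ (ModuleCat.ofHom (LinearMap.snd R M N))) _)]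

/-- In the long exact sequence, `Ext^n(k, X₁)` sits between `Ext^(n-1)(k, X₃)` and `Ext^n(k, X₂)`.
-/
lemma isMCM.of_shortExact {S : ShortComplex (ModuleCat.{u} R)} [IsNoetherianRing R]
    (hS : S.ShortExact) (h₂ : isMCM R S.X₂) (h₃ : isMCM R S.X₃) : isMCM R S.X₁ := by
  refine ⟨?_, fun n hn => ?_⟩
  · have := h₂.1
    exact Module.Finite.of_injective S.f.hom hS.moduleCat_injective_f
  · refine subsingleton_of_forall_eq 0 fun x => ?_
    have := h₂.2 n hn
    cases n with
    | zero =>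
      have := hS.mono_f
      exact Ext.postcomp_mk₀_injective_of_mono (residueModule R) S.f (Subsingleton.elim _ _)
    | succ n =>
      have := h₃.2 n (lt_of_le_of_lt (by exact_mod_cast Nat.le_succ n) hn)
      obtain ⟨y, rfl⟩ := Ext.covariant_sequence_exact₁ (residueModule R) hS x
        (Subsingleton.elim _ _) (n₀ := n) rfl
      rw [Subsingleton.elim y 0, Ext.zero_comp]

lemma isMCM.ker [IsNoetherianRing R] {M N : ModuleCat.{u} R} (hM : isMCM R M) (hN : isMCM R N)
    {f : M →ₗ[R] N} (hf : Function.Surjective f) : isMCM R (ModuleCat.of R (LinearMap.ker f)) :=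
  isMCM.of_shortExact (LinearMap.shortExact_shortComplexKer hf) hM hN

lemma isMCM_linearPullback [IsNoetherianRing R] {M₀ M₁ X : ModuleCat.{u} R} (h₀ : isMCM R M₀)
    (h₁ : isMCM R M₁) (hX : isMCM R X) {γ : M₁ →ₗ[R] M₀} (hγ : Function.Surjective γ)
    (f : X →ₗ[R] M₀) : isMCM R (ModuleCat.of R (linearPullback γ f)) := by
  refine isMCM.ker (M := ModuleCat.of R (M₁ × X)) (N := M₀) (h₁.prod hX) h₀
    (f := γ ∘ₗ LinearMap.fst R M₁ X - f ∘ₗ LinearMap.snd R M₁ X) fun x => ?_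
  obtain ⟨a, rfl⟩ := hγ x
  exact ⟨(a, 0), by simp⟩

end MCMClosure

/-! ### Minimal numbers of generators. -/

section Generators

variable (R : Type*) [CommRing R] [IsLocalRing R]

open TensorProduct

/-- The minimal number of generators of a finite module over a local ring. -/
noncomputable def minGens (M : Type*) [AddCommGroup M] [Module R M] : ℕ :=
  Module.finrank (ResidueField R) (ResidueField R ⊗[R] M)

variable {R} {A B C : Type*} [AddCommGroup A] [Module R A] [AddCommGroup B] [Module R B]
  [AddCommGroup C] [Module R C]

lemma minGens_congr (e : A ≃ₗ[R] B) : minGens R A = minGens R B :=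
  (e.baseChange R (ResidueField R) A B).finrank_eq

lemma minGens_prod [Module.Finite R A] [Module.Finite R B] : minGens R (A × B) = minGens R A + minGens R B :=
  (TensorProduct.prodRight R (ResidueField R) (ResidueField R) A B).finrank_eq.trans
    Module.finrank_prod

lemma minGens_pos [Module.Finite R A] [Nontrivial A] : 0 < minGens R A := by
  have : Nontrivial (ResidueField R ⊗[R] A) := by
    rw [← not_subsingleton_iff_nontrivial, subsingleton_tensorProduct]
    exact not_subsingleton A
  exact Module.finrank_pos

lemma minGens_le_of_exact [Module.Finite R A] [Module.Finite R B] [Module.Finite R C] {i : A →ₗ[R] B} {p : B →ₗ[R] C} (h : Function.Exact i p)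
    (hp : Function.Surjective p) : minGens R B ≤ minGens R A + minGens R C := by
  have hex : Function.Exact (i.baseChange (ResidueField R)) (p.baseChange (ResidueField R)) :=
    lTensor_exact (ResidueField R) h hp
  have h1 := LinearMap.finrank_range_add_finrank_ker (p.baseChange (ResidueField R))
  rw [hex.linearMap_ker_eq] at h1
  have h2 := LinearMap.finrank_range_le (i.baseChange (ResidueField R))
  have h3 := Submodule.finrank_le (LinearMap.range (p.baseChange (ResidueField R)))
  unfold minGens
  omega

end Generators

/-! ### Decomposition into indecomposables, and the pigeonhole argument. -/

section Decomposition

variable {R : Type u} [CommRing R]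

/-- The direct sum of a finite list of members of a family of modules. -/
def listSum {ι : Type*} (X : ι → ModuleCat.{u} R) : List ι → ModuleCat.{u} R
  | [] => ModuleCat.of R PUnit
  | i :: l => ModuleCat.of R (X i × listSum X l)

lemma nonempty_listSum_append {ι : Type*} (X : ι → ModuleCat.{u} R) (l₁ l₂ : List ι) :
    Nonempty ((listSum X l₁ × listSum X l₂) ≃ₗ[R] listSum X (l₁ ++ l₂)) := by
  induction l₁ with
  | nil => exact ⟨(LinearEquiv.uniqueProd (M₂ := (PUnit : Type u)) : (PUnit × _) ≃ₗ[R] _)⟩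
  | cons i l ih =>
    obtain ⟨e⟩ := ih
    exact ⟨(LinearEquiv.prodAssoc R (X i) (listSum X l) (listSum X l₂)).trans
      ((LinearEquiv.refl R (X i)).prodCongr e)⟩

variable [IsLocalRing R]

/-- Maximal Cohen-Macaulay modules are finite direct sums of indecomposable ones. -/
theorem isMCM.induction_indecomposable {P : ∀ M : ModuleCat.{u} R, isMCM R M → Prop}
    (zero : ∀ (M : ModuleCat.{u} R) hM, Subsingleton M → P M hM)
    (indecomposable : ∀ M hM, Indecomposable M → P M hM)
    (prod : ∀ (M A B : ModuleCat.{u} R) hM hA hB, (M ≃ₗ[R] (A × B)) → P A hA → P B hB → P M hM)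
    (M : ModuleCat.{u} R) (hM : isMCM R M) : P M hM := by
  -- The number of generators is additive on direct sums and positive on nonzero modules, so it
  -- drops on proper summands.
  induction hn : minGens R M using Nat.strong_induction_on generalizing M with
  | _ n ih =>
    rcases subsingleton_or_nontrivial M with h | h
    · exact zero M hM h
    by_cases hi : Indecomposable M
    · exact indecomposable M hM hi
    have hz : ¬ IsZero M := by
      rw [ModuleCat.isZero_iff_subsingleton, not_subsingleton_iff_nontrivial]
      exact h
    simp only [Indecomposable, hz, not_false_eq_true, true_and, not_forall, not_or] at hi
    obtain ⟨A, B, e, hA, hB⟩ := hi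
    have hA' : isMCM R A := hM.of_retract (biprod.inl ≫ e.inv) (e.hom ≫ biprod.fst) (by simp)
    have hB' : isMCM R B := hM.of_retract (biprod.inr ≫ e.inv) (e.hom ≫ biprod.snd) (by simp)
    rw [ModuleCat.isZero_iff_subsingleton, not_subsingleton_iff_nontrivial] at hA hB
    have e' : M ≃ₗ[R] (A × B) := (e ≪≫ ModuleCat.biprodIsoProd A B).toLinearEquiv
    have := hM.1
    have := hA'.1
    have := hB'.1
    have h1 := minGens_congr e'
    rw [minGens_prod, hn] at h1
    have h2 := minGens_pos (R := R) (A := A)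
    have h3 := minGens_pos (R := R) (A := B)
    exact prod M A B hM hA' hB' e' (ih _ (by omega) A hA' rfl) (ih _ (by omega) B hB' rfl)

/-- Every maximal Cohen-Macaulay module is a direct sum of at most as many indecomposables as it
has generators. -/
lemma isMCM.exists_listSum {ι : Type*} {X : ι → ModuleCat.{u} R}
    (hX : ∀ M, isMCM R M → Indecomposable M → ∃ i, Nonempty (M ≅ X i)) {M : ModuleCat.{u} R}
    (hM : isMCM R M) :
    ∃ l : List ι, l.length ≤ minGens R M ∧ Nonempty (M ≃ₗ[R] listSum X l) := by
  induction M, hM using isMCM.induction_indecomposable with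
  | zero M hM h =>
    exact ⟨[], Nat.zero_le _,
      ⟨(LinearEquiv.ofSubsingleton M (PUnit.{u + 1}) : M ≃ₗ[R] PUnit.{u + 1})⟩⟩
  | indecomposable M hM hi =>
    obtain ⟨i, ⟨e⟩⟩ := hX M hM hi
    have : Nontrivial M := by
      rw [← not_subsingleton_iff_nontrivial, ← ModuleCat.isZero_iff_subsingleton]
      exact hi.1
    have := hM.1
    exact ⟨[i], minGens_pos, ⟨e.toLinearEquiv.trans
      (LinearEquiv.prodUnique (M₂ := PUnit.{u + 1}) : (X i × PUnit.{u + 1}) ≃ₗ[R] X i).symm⟩⟩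
  | prod M A B hM hA hB e ih₁ ih₂ =>
    obtain ⟨l₁, h₁, ⟨e₁⟩⟩ := ih₁
    obtain ⟨l₂, h₂, ⟨e₂⟩⟩ := ih₂
    refine ⟨l₁ ++ l₂, ?_, ?_⟩
    · have := hA.1
      have := hB.1
      rw [List.length_append, minGens_congr e, minGens_prod]
      omega
    · obtain ⟨e₃⟩ := nonempty_listSum_append X l₁ l₂
      exact ⟨(e.trans (e₁.prodCongr e₂)).trans e₃⟩

/-- If there are finitely many indecomposables, then for a surjection `γ : M₁ → M₀` of maximal
Cohen-Macaulay modules every map `f : X → M₀` factors through `γ` after multiplication with a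
power of any nonunit. -/
theorem isMCM.exists_pow_smul_eq_comp [IsNoetherianRing R] {ι : Type*} [Finite ι]
    {X : ι → ModuleCat.{u} R}
    (hX : ∀ M, isMCM R M → Indecomposable M → ∃ i, Nonempty (M ≅ X i)) {M₀ M₁ N : ModuleCat.{u} R}
    (h₀ : isMCM R M₀) (h₁ : isMCM R M₁) (hN : isMCM R N) {γ : M₁ →ₗ[R] M₀}
    (hγ : Function.Surjective γ) (f : N →ₗ[R] M₀) {r : R} (hr : r ∈ maximalIdeal R) :
    ∃ (n : ℕ) (g : N →ₗ[R] M₁), r ^ n • f = γ ∘ₗ g := by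
  have := h₀.1
  have := h₁.1
  have := hN.1
  have hex (n : ℕ) := (isMCM_linearPullback h₀ h₁ hN hγ (r ^ n • f)).exists_listSum hX
  choose l hl he using hex
  -- Each pullback is an extension of `N` by `ker γ`, so this bound does not depend on `n`.
  set b := minGens R (LinearMap.ker γ) + minGens R N
  have hb (n : ℕ) : (l n).length ≤ b := by
    refine (hl n).trans ?_
    let i : LinearMap.ker γ →ₗ[R] linearPullback γ (r ^ n • f) :=
      LinearMap.codRestrict _ (LinearMap.inl R M₁ N ∘ₗ Submodule.subtype _)
        (fun x => mem_linearPullback.mpr (by simp))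
    let p : linearPullback γ (r ^ n • f) →ₗ[R] N := LinearMap.snd R M₁ N ∘ₗ Submodule.subtype _
    refine minGens_le_of_exact (i := i) (p := p) ?_ ?_
    · rintro ⟨⟨a, y⟩, h⟩
      rw [mem_linearPullback] at h
      constructor
      · intro h0
        have h0 : y = 0 := h0
        subst h0
        exact ⟨⟨a, by simpa using h⟩, rfl⟩
      · rintro ⟨x, hx⟩
        rw [← hx]
        rfl
    · intro x
      obtain ⟨a, ha⟩ := hγ ((r ^ n • f) x)
      exact ⟨⟨(a, x), mem_linearPullback.mpr ha⟩, rfl⟩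
  have := (List.finite_length_le ι b).to_subtype
  -- There are only finitely many lists of bounded length over a finite index type, so infinitely
  -- many exponents give the same decomposition.
  obtain ⟨l₀, hl₀⟩ := Finite.exists_infinite_fiber
    (fun n => (⟨l n, hb n⟩ : {l : List ι | l.length ≤ b}))
  refine _root_.exists_pow_smul_eq_comp hγ f hr (Set.infinite_coe_iff.mp hl₀) fun m hm n hn => ?_
  obtain ⟨em⟩ := he m
  obtain ⟨en⟩ := he n
  have h : l m = l n := congrArg Subtype.val (hm.trans hn.symm)
  rw [← h] at en
  exact ⟨em.trans en.symm⟩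

/-- The identity of a maximal Cohen-Macaulay module is a sum of maps which factor through
indecomposables. -/
theorem isMCM.id_mem_closure {ι : Type*} {X : ι → ModuleCat.{u} R}
    (hX : ∀ M, isMCM R M → Indecomposable M → ∃ i, Nonempty (M ≅ X i)) {M : ModuleCat.{u} R}
    (hM : isMCM R M) :
    𝟙 M ∈ AddSubgroup.closure {φ | ∃ (i : ι) (a : M ⟶ X i) (b : X i ⟶ M), φ = a ≫ b} := by
  have hcomp {A N : ModuleCat.{u} R} (a : N ⟶ A) (b : A ⟶ N)
      (h : 𝟙 A ∈ AddSubgroup.closure {φ | ∃ (i : ι) (a : A ⟶ X i) (b : X i ⟶ A), φ = a ≫ b}) :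
      a ≫ b ∈ AddSubgroup.closure {φ | ∃ (i : ι) (a : N ⟶ X i) (b : X i ⟶ N), φ = a ≫ b} := by
    have key : AddSubgroup.closure {φ | ∃ (i : ι) (a : A ⟶ X i) (b : X i ⟶ A), φ = a ≫ b} ≤
        (AddSubgroup.closure {φ | ∃ (i : ι) (a : N ⟶ X i) (b : X i ⟶ N), φ = a ≫ b}).comap
          ((Preadditive.leftComp N a).comp (Preadditive.rightComp A b)) := by
      rw [AddSubgroup.closure_le]
      rintro _ ⟨i, a', b', rfl⟩
      exact AddSubgroup.subset_closure ⟨i, a ≫ a', b' ≫ b, by simp [Preadditive.leftComp, Preadditive.rightComp]⟩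
    simpa [Preadditive.leftComp, Preadditive.rightComp] using key h
  induction M, hM using isMCM.induction_indecomposable with
  | zero M hM h =>
    rw [(ModuleCat.isZero_of_subsingleton M).eq_of_src (𝟙 M) 0]
    exact zero_mem _
  | indecomposable M hM hi =>
    obtain ⟨i, ⟨e⟩⟩ := hX M hM hi
    exact AddSubgroup.subset_closure ⟨i, e.hom, e.inv, by simp⟩
  | prod M A B _ _ _ e hA hB =>
    have h : 𝟙 M =
        ModuleCat.ofHom (LinearMap.fst R A B ∘ₗ e.toLinearMap) ≫
          ModuleCat.ofHom (e.symm.toLinearMap ∘ₗ LinearMap.inl R A B) +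
        ModuleCat.ofHom (LinearMap.snd R A B ∘ₗ e.toLinearMap) ≫
          ModuleCat.ofHom (e.symm.toLinearMap ∘ₗ LinearMap.inr R A B) := by
      ext x
      change x = e.symm ((e x).1, 0) + e.symm (0, (e x).2)
      rw [← map_add]
      simp
    rw [h]
    exact add_mem (hcomp _ _ hA) (hcomp _ _ hB)

end Decomposition

/-! ### Endomorphism rings of indecomposables are local. -/

section LocalEnd

variable {R : Type u} [CommRing R]

/-- An idempotent splits `M` as range plus kernel, so it is trivial; endomorphisms of a finite
module are integral over `R`. -/
theorem ModuleCat.isUnit_or_isUnit_one_sub_of_indecomposable [HenselianLocalRing R]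
    {M : ModuleCat.{u} R} [Module.Finite R M] (hM : Indecomposable M) (φ : Module.End R M) :
    IsUnit φ ∨ IsUnit (1 - φ) := by
  refine HenselianLocalRing.isUnit_or_isUnit_one_sub (R := R) (fun e he => ?_)
    (Algebra.IsIntegral.isIntegral φ)
  let e' : M ≅ ModuleCat.of R (LinearMap.range e) ⊞ ModuleCat.of R (LinearMap.ker e) :=
    (Submodule.prodEquivOfIsCompl _ _ (LinearMap.IsIdempotentElem.isCompl he)).symm.toModuleIso ≪≫
      (ModuleCat.biprodIsoProd (ModuleCat.of R (LinearMap.range e))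
        (ModuleCat.of R (LinearMap.ker e))).symm
  rcases hM.2 _ _ e' with h | h
  · left
    rw [ModuleCat.isZero_iff_subsingleton] at h
    exact LinearMap.range_eq_bot.mp (Submodule.subsingleton_iff_eq_bot.mp h)
  · right
    rw [ModuleCat.isZero_iff_subsingleton] at h
    have hinj := LinearMap.ker_eq_bot.mp (Submodule.subsingleton_iff_eq_bot.mp h)
    exact LinearMap.ext fun x => hinj (LinearMap.congr_fun he x)

theorem MCMCat.isUnit_or_isUnit_one_sub [HenselianLocalRing R] {M : MCMCat R}
    (hM : Indecomposable M.obj) (φ : End M) : IsUnit φ ∨ IsUnit (1 - φ) := by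
  have := M.property.1
  have key (ψ : M ⟶ M) (h : IsUnit (M := Module.End R M.obj) ψ.hom.hom) :
      IsUnit (End.of ψ) := by
    rw [isUnit_iff_isIso]
    have : IsIso ψ.hom := by
      rw [ConcreteCategory.isIso_iff_bijective]
      exact (Module.End.isUnit_iff _).mp h
    exact (ObjectProperty.isIso_hom_iff _).mp this
  exact (ModuleCat.isUnit_or_isUnit_one_sub_of_indecomposable hM
    (φ.asHom.hom.hom : Module.End R M.obj)).imp (key φ.asHom) (key (𝟙 M - φ.asHom))

end LocalEnd

universe v w

/-! ### The Jacobson radical of a noncommutative local ring. -/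

section LocalRing

/-- In a ring such that for every `x` one of `x`, `1 - x` is a unit, the elements outside the
Jacobson radical are units. -/
lemma isUnit_of_notMem_jacobson {E : Type*} [Ring E] (h : ∀ x : E, IsUnit x ∨ IsUnit (1 - x))
    {x : E} (hx : x ∉ Ring.jacobson E) : IsUnit x := by
  rw [← Ideal.jacobson_bot, Ideal.mem_jacobson_iff] at hx
  push Not at hx
  obtain ⟨y, hy⟩ := hx
  have hyx : IsUnit (y * x) := by
    rcases h (-(y * x)) with h | h
    · exact (IsUnit.neg_iff _).mp h
    · rw [sub_neg_eq_add] at h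
      obtain ⟨z, hz⟩ := h.exists_left_inv
      refine absurd ?_ (hy z)
      rw [Ideal.mem_bot, ← hz]
      noncomm_ring
  obtain ⟨c, hc⟩ := hyx.exists_left_inv
  rw [← mul_assoc] at hc
  -- The left inverse is two-sided: if `1 - x (c y)` were a unit, `(1 - x (c y)) x = 0` would give
  -- `x = 0` and hence `1 = 0`.
  have key : x * (c * y) = 1 := by
    rcases h (x * (c * y)) with h | h
    · refine h.mul_left_cancel ?_
      rw [mul_one, mul_assoc, ← mul_assoc (c * y), hc, one_mul]
    · have h0 : (1 - x * (c * y)) * x = (1 - x * (c * y)) * 0 := by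
        rw [sub_mul, one_mul, mul_assoc, hc, mul_one, sub_self, mul_zero]
      have hx0 := h.mul_left_cancel h0
      have : (1 : E) = 0 := by rw [← hc, hx0, mul_zero]
      exact eq_of_zero_eq_one this.symm _ _
  exact isUnit_iff_exists.mpr ⟨c * y, key, hc⟩

lemma isUnit_one_sub_of_mem_jacobson {E : Type*} [Ring E]
    (h : ∀ x : E, IsUnit x ∨ IsUnit (1 - x)) {x : E} (hx : x ∈ Ring.jacobson E) :
    IsUnit (1 - x) := by
  rcases h x with h | h
  · have htop := Ideal.eq_top_of_isUnit_mem _ hx h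
    rw [← Ideal.jacobson_bot, Ideal.jacobson_eq_top_iff] at htop
    have := subsingleton_of_bot_eq_top htop
    have : Subsingleton E := (Submodule.subsingleton_iff E).mp this
    exact isUnit_of_subsingleton _
  · exact h

end LocalRing

/-! ### Elements of additive functors. -/

section AdditiveFunctorElements

variable {A : Type w} [Category.{v} A] [Preadditive A]

namespace CategoryTheory.AdditiveFunctor

/-- The action of a map on the elements of a contravariant additive functor. -/
def act (F : Aᵒᵖ ⥤+ AddCommGrpCat.{v}) {X Y : A} (h : Y ⟶ X) :
    F.obj.obj (op X) →+ F.obj.obj (op Y) :=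
  (F.obj.map h.op).hom

/-- The components of a map of contravariant additive functors. -/
def comp {F G : Aᵒᵖ ⥤+ AddCommGrpCat.{v}} (τ : F ⟶ G) (X : A) :
    F.obj.obj (op X) →+ G.obj.obj (op X) :=
  (τ.hom.app (op X)).hom

section

variable {F G H : Aᵒᵖ ⥤+ AddCommGrpCat.{v}}

@[simp]
lemma act_id {X : A} (x : F.obj.obj (op X)) : act F (𝟙 X) x = x := by
  simp [act]

@[simp]
lemma act_comp {X Y Z : A} (h : Y ⟶ X) (g : Z ⟶ Y) (x : F.obj.obj (op X)) :
    act F (g ≫ h) x = act F g (act F h x) := by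
  simp [act]

@[simp]
lemma act_add {X Y : A} (h g : Y ⟶ X) (x : F.obj.obj (op X)) :
    act F (h + g) x = act F h x + act F g x := by
  have : F.obj.Additive := F.property
  simp [act, Functor.map_add]

@[simp]
lemma act_zero {X Y : A} (x : F.obj.obj (op X)) : act F (0 : Y ⟶ X) x = 0 := by
  have : F.obj.Additive := F.property
  simp [act]

@[simp]
lemma act_neg {X Y : A} (h : Y ⟶ X) (x : F.obj.obj (op X)) : act F (-h) x = -act F h x := by
  have : F.obj.Additive := F.property
  simp [act, Functor.map_neg]

lemma act_sub {X Y : A} (h g : Y ⟶ X) (x : F.obj.obj (op X)) :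
    act F (h - g) x = act F h x - act F g x := by
  rw [sub_eq_add_neg, act_add, act_neg, sub_eq_add_neg]

lemma comp_act (τ : F ⟶ G) {X Y : A} (h : Y ⟶ X) (x : F.obj.obj (op X)) :
    comp τ Y (act F h x) = act G h (comp τ X x) :=
  congr($(τ.hom.naturality h.op).hom x)

@[simp]
lemma comp_comp (τ : F ⟶ G) (σ : G ⟶ H) (X : A) (x : F.obj.obj (op X)) :
    comp (τ ≫ σ) X x = comp σ X (comp τ X x) :=
  rfl

@[simp]
lemma comp_zero (X : A) (x : F.obj.obj (op X)) : comp (0 : F ⟶ G) X x = 0 :=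
  rfl

@[simp]
lemma comp_id (X : A) (x : F.obj.obj (op X)) : comp (𝟙 F) X x = x :=
  rfl

lemma hom_ext {τ σ : F ⟶ G} (h : ∀ X x, comp τ X x = comp σ X x) : τ = σ := by
  refine ObjectProperty.hom_ext _ (NatTrans.ext (funext fun X => ?_))
  ext x
  exact h X.unop x

lemma epi_iff_surjective (τ : F ⟶ G) : Epi τ ↔ ∀ X, Function.Surjective (comp τ X) := by
  constructor
  · intro h X
    have : (additiveFunctor Aᵒᵖ AddCommGrpCat.{v}).ι.PreservesEpimorphisms :=
      ObjectProperty.preservesEpimorphisms_ι_of_isNormalMonoCategory _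
    have h1 : Epi τ.hom := (additiveFunctor Aᵒᵖ AddCommGrpCat.{v}).ι.map_epi τ
    have h2 : Epi (τ.hom.app (op X)) := inferInstance
    exact (AddCommGrpCat.epi_iff_surjective _).mp h2
  · intro h
    have (X : Aᵒᵖ) : Epi (τ.hom.app X) := (AddCommGrpCat.epi_iff_surjective _).mpr (h X.unop)
    have : Epi ((additiveFunctor Aᵒᵖ AddCommGrpCat.{v}).ι.map τ) :=
      NatTrans.epi_of_epi_app τ.hom
    exact (additiveFunctor Aᵒᵖ AddCommGrpCat.{v}).ι.epi_of_epi_map this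

lemma mono_iff_injective (τ : F ⟶ G) : Mono τ ↔ ∀ X, Function.Injective (comp τ X) := by
  constructor
  · intro h X
    have : (additiveFunctor Aᵒᵖ AddCommGrpCat.{v}).ι.PreservesMonomorphisms :=
      ObjectProperty.preservesMonomorphisms_ι_of_isNormalEpiCategory _
    have h1 : Mono τ.hom := (additiveFunctor Aᵒᵖ AddCommGrpCat.{v}).ι.map_mono τ
    have h2 : Mono (τ.hom.app (op X)) := inferInstance
    exact (AddCommGrpCat.mono_iff_injective _).mp h2
  · intro h
    have (X : Aᵒᵖ) : Mono (τ.hom.app X) := (AddCommGrpCat.mono_iff_injective _).mpr (h X.unop)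
    have : Mono ((additiveFunctor Aᵒᵖ AddCommGrpCat.{v}).ι.map τ) :=
      NatTrans.mono_of_mono_app τ.hom
    exact (additiveFunctor Aᵒᵖ AddCommGrpCat.{v}).ι.mono_of_mono_map this

/-- A map of functors from compatible maps of groups. -/
def homOfComp (f : ∀ X : A, F.obj.obj (op X) →+ G.obj.obj (op X))
    (hf : ∀ {X Y : A} (h : Y ⟶ X) (x : F.obj.obj (op X)), f Y (act F h x) = act G h (f X x)) :
    F ⟶ G :=
  ObjectProperty.homMk
    { app := fun X => AddCommGrpCat.ofHom (f X.unop)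
      naturality := fun X Y h => by
        ext x
        exact hf h.unop x }

/-- The elements of a representable functor are maps. -/
def toYoneda {X Y : A} (f : Y ⟶ X) : (additiveYoneda.obj X).obj.obj (op Y) := f

/-- The elements of a representable functor are maps. -/
def ofYoneda {X Y : A} (f : (additiveYoneda.obj X).obj.obj (op Y)) : Y ⟶ X := f

@[simp]
lemma act_toYoneda {X Y Z : A} (f : Y ⟶ X) (h : Z ⟶ Y) :
    act (additiveYoneda.obj X) h (toYoneda f) = toYoneda (h ≫ f) :=
  rfl

lemma comp_map_toYoneda {X X' Y : A} (f : Y ⟶ X) (h : X ⟶ X') :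
    comp (additiveYoneda.map h) Y (toYoneda f) = toYoneda (f ≫ h) :=
  rfl

/-- The map out of a representable functor given by an element. -/
def yonedaHom {X : A} (x : F.obj.obj (op X)) : additiveYoneda.obj X ⟶ F :=
  homOfComp (F := additiveYoneda.obj X)
    (fun _ => AddMonoidHom.mk' (fun f => act F (ofYoneda f) x) (fun _ _ => act_add _ _ x))
    (fun h f => act_comp (ofYoneda f) h x)

@[simp]
lemma comp_yonedaHom {X Y : A} (x : F.obj.obj (op X)) (f : Y ⟶ X) :
    comp (yonedaHom x) Y (toYoneda f) = act F f x :=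
  rfl

lemma yonedaHom_comp {X : A} (x : F.obj.obj (op X)) (τ : F ⟶ G) :
    yonedaHom x ≫ τ = yonedaHom (comp τ X x) :=
  hom_ext fun _ f => comp_act τ (ofYoneda f) x

lemma yonedaHom_eq_zero_iff {X : A} (x : F.obj.obj (op X)) : yonedaHom x = 0 ↔ x = 0 := by
  constructor
  · intro h
    have := comp_yonedaHom x (𝟙 X)
    rwa [h, comp_zero, act_id, eq_comm] at this
  · rintro rfl
    exact hom_ext fun _ f => map_zero (act F (ofYoneda f))

/-- Exactness of functors gives exactness on elements. -/
lemma exists_comp_eq_of_exact {S : ShortComplex (Aᵒᵖ ⥤+ AddCommGrpCat.{v})} (hS : S.Exact) {X : A}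
    (x : S.X₂.obj.obj (op X)) (hx : comp S.g X x = 0) : ∃ y, comp S.f X y = x := by
  -- The element is viewed as a map out of `Hom(-, X)`. Exactness lifts it after an epimorphism `π`,
  -- and a preimage of the identity under `π` gives the desired element.
  obtain ⟨T, π, hπ, x₁, h⟩ := (S.exact_iff_exact_up_to_refinements.mp hS) (yonedaHom x)
    (by rw [yonedaHom_comp, hx, yonedaHom_eq_zero_iff])
  obtain ⟨t, ht⟩ := (epi_iff_surjective π).mp hπ X (toYoneda (𝟙 X))
  refine ⟨comp x₁ X t, ?_⟩
  rw [← comp_comp, ← h, comp_comp, ht, comp_yonedaHom, act_id]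

/-- Factorization through a monomorphism can be tested on elements. -/
lemma exists_factor {τ : F ⟶ H} {σ : G ⟶ H} [Mono σ]
    (h : ∀ X x, comp τ X x ∈ (comp σ X).range) : ∃ ρ : F ⟶ G, ρ ≫ σ = τ := by
  have h0 : τ ≫ cokernel.π σ = 0 := hom_ext fun X x => by
    obtain ⟨y, hy⟩ := h X x
    rw [comp_comp, ← hy, ← comp_comp, cokernel.condition]
    rfl
  exact ⟨(Abelian.monoIsKernelOfCokernel _ (cokernelIsCokernel σ)).lift (KernelFork.ofι τ h0),
    (Abelian.monoIsKernelOfCokernel _ (cokernelIsCokernel σ)).fac (KernelFork.ofι τ h0)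
      WalkingParallelPair.zero⟩

/-- The range of a map between functors is determined by its values on a generating family. -/
lemma range_le_range_of_generators {ι : Type*} {X : ι → A}
    (hX : ∀ Y : A, 𝟙 Y ∈ AddSubgroup.closure
      {φ | ∃ (i : ι) (a : Y ⟶ X i) (b : X i ⟶ Y), φ = a ≫ b})
    {τ : F ⟶ H} {σ : G ⟶ H} (h : ∀ i x, comp τ (X i) x ∈ (comp σ (X i)).range) (Y : A)
    (y : F.obj.obj (op Y)) : comp τ Y y ∈ (comp σ Y).range := by
  suffices hφ : ∀ φ ∈ AddSubgroup.closure
      {φ | ∃ (i : ι) (a : Y ⟶ X i) (b : X i ⟶ Y), φ = a ≫ b},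
      act H φ (comp τ Y y) ∈ (comp σ Y).range by
    simpa using hφ _ (hX Y)
  intro φ hφ
  induction hφ using AddSubgroup.closure_induction with
  | mem φ hφ =>
    obtain ⟨i, a, b, rfl⟩ := hφ
    obtain ⟨z, hz⟩ := h i (act F b y)
    exact ⟨act G a z, by rw [comp_act, hz, act_comp, comp_act]⟩
  | zero => rw [act_zero]; exact zero_mem _
  | add φ ψ _ _ h₁ h₂ => rw [act_add]; exact add_mem h₁ h₂
  | neg φ _ h => rw [act_neg]; exact neg_mem h

end

/-! ### Simple functors. -/

section Simple

variable {F : Aᵒᵖ ⥤+ AddCommGrpCat.{v}}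

/-- For a quotient map `f` of the cokernel, the kernel of `G' → Z` lies between `G` and `G'`. If it
is `G`, then `f` is an isomorphism; if it is `G'`, then `f = 0`. -/
lemma simple_cokernel_of_covBy {G G' : Subobject F} (h : G ⋖ G') :
    Simple (cokernel (Subobject.ofLE G G' h.le)) := by
  set π := cokernel.π (Subobject.ofLE G G' h.le)
  refine simple_of_cosimple _ fun {Z} f _ => ⟨?_, fun hf => ?_⟩
  · rintro hf rfl
    have h1 : π = 0 := by
      rw [← cancel_mono (0 : cokernel (Subobject.ofLE G G' h.le) ⟶ Z), zero_comp]
      simp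
    have : Epi (Subobject.ofLE G G' h.le) := Preadditive.epi_of_cokernel_zero h1
    have : IsIso (Subobject.ofLE G G' h.le) := isIso_of_mono_of_epi _
    refine h.lt.not_ge (Subobject.le_of_comm (inv (Subobject.ofLE G G' h.le)) ?_)
    rw [IsIso.inv_comp_eq, Subobject.ofLE_arrow]
  · let K : Subobject F := Subobject.mk (kernel.ι (π ≫ f) ≫ G'.arrow)
    have hGK : G ≤ K := Subobject.le_mk_of_comm
      (kernel.lift (π ≫ f) (Subobject.ofLE G G' h.le)
        (by rw [cokernel.condition_assoc, zero_comp])) (by simp)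
    have hKG' : K ≤ G' := Subobject.mk_le_of_comm (kernel.ι (π ≫ f)) rfl
    rcases h.eq_or_eq hGK hKG' with hK | hK
    · have hmono : Mono f := by
        rw [mono_iff_injective]
        intro X
        rw [injective_iff_map_eq_zero]
        intro z hz
        obtain ⟨x, rfl⟩ := (epi_iff_surjective π).mp inferInstance X z
        have h1 : yonedaHom x ≫ π ≫ f = 0 := by
          rw [yonedaHom_comp, yonedaHom_eq_zero_iff, comp_comp, hz]
        have h2 : K.Factors (yonedaHom x ≫ G'.arrow) := by
          refine (Subobject.mk_factors_iff _ _).mpr ⟨kernel.lift _ _ h1, ?_⟩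
          simp [MonoOver.arrow]
        rw [hK] at h2
        have h3 : yonedaHom x = G.factorThru _ h2 ≫ Subobject.ofLE G G' h.le := by
          rw [← cancel_mono G'.arrow]
          simp
        rw [← yonedaHom_eq_zero_iff, ← yonedaHom_comp, h3, Category.assoc, cokernel.condition,
          CategoryTheory.Limits.comp_zero]
      exact isIso_of_mono_of_epi f
    · exfalso
      apply hf
      have h1 : Subobject.mk (kernel.ι (π ≫ f) ≫ G'.arrow) = Subobject.mk G'.arrow := by
        rw [Subobject.mk_arrow]; exact hK
      let e := Subobject.isoOfMkEqMk _ _ h1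
      have he : e.inv ≫ kernel.ι (π ≫ f) = 𝟙 _ := by
        rw [← cancel_mono G'.arrow, Category.assoc, Category.id_comp]
        exact Subobject.ofMkLEMk_comp _
      rw [← cancel_epi π, CategoryTheory.Limits.comp_zero, ← Category.id_comp (π ≫ f), ← he,
        Category.assoc, kernel.condition, CategoryTheory.Limits.comp_zero]

/-- A simple functor with a nonzero element in `X`, where `End X` is local, is `S_X`. -/
lemma nonempty_iso_simpleFunctor [Simple F] {X : A}
    (hX : ∀ φ : End X, IsUnit φ ∨ IsUnit (1 - φ)) {q : F.obj.obj (op X)} (hq : q ≠ 0) :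
    Nonempty (F ≅ simpleFunctor X) := by
  -- In a simple functor every nonzero element generates.
  have hgen {Y : A} {y : F.obj.obj (op Y)} (hy : y ≠ 0) {Z : A} (z : F.obj.obj (op Z)) :
      ∃ h : Z ⟶ Y, act F h y = z := by
    have : Epi (yonedaHom y) :=
      epi_of_nonzero_to_simple (mt (yonedaHom_eq_zero_iff y).mp hy)
    obtain ⟨h, hh⟩ := (epi_iff_surjective _).mp this Z z
    exact ⟨ofYoneda h, hh⟩
  have hunit {φ : X ⟶ X} (hφ : IsUnit (End.of φ)) (h0 : act F φ q = 0) : False := by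
    rw [isUnit_iff_isIso] at hφ
    have : IsIso φ := hφ
    apply hq
    rw [← act_id (F := F) q, ← IsIso.inv_hom_id φ, act_comp, h0, map_zero]
  -- The annihilator of `q` is the radical. A map outside it has a composite `g ≫ h` that is a unit
  -- and cannot kill `q`. If a radical map did not kill `q`, some `g ≫ h` would fix `q`, so the unit
  -- `1 - g ≫ h` would kill it.
  have hrad {Y : A} (h : Y ⟶ X) : act F h q = 0 ↔ h ∈ radHom Y X := by
    constructor
    · intro h0
      by_contra hh
      obtain ⟨g, hg⟩ : ∃ g : X ⟶ Y, End.of (g ≫ h) ∉ Ring.jacobson (End X) := by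
        by_contra! hc
        exact hh hc
      exact hunit (isUnit_of_notMem_jacobson hX hg) (by rw [act_comp, h0, map_zero])
    · intro hh
      by_contra h0
      obtain ⟨g, hg⟩ := hgen h0 q
      refine hunit (φ := 𝟙 X - g ≫ h) (isUnit_one_sub_of_mem_jacobson hX (hh g)) ?_
      rw [act_sub, act_id, act_comp, hg, sub_self]
  let f (Y : A) : (simpleFunctor X).obj.obj (op Y) →+ F.obj.obj (op Y) :=
    QuotientAddGroup.lift (radHom Y X)
      (AddMonoidHom.mk' (fun h => act F h q) (fun g h => act_add g h q))
      (fun h hh => (hrad h).mpr hh)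
  let σ : simpleFunctor X ⟶ F := homOfComp f (by
    intro Y Z h x
    obtain ⟨x, rfl⟩ := QuotientAddGroup.mk_surjective x
    exact act_comp x h q)
  have : Mono σ := by
    rw [mono_iff_injective]
    intro Y
    rw [injective_iff_map_eq_zero]
    intro x hx
    obtain ⟨x, rfl⟩ := QuotientAddGroup.mk_surjective x
    exact (QuotientAddGroup.eq_zero_iff x).mpr ((hrad x).mp hx)
  have : Epi σ := by
    rw [epi_iff_surjective]
    intro Y y
    obtain ⟨h, hh⟩ := hgen hq y
    exact ⟨QuotientAddGroup.mk h, hh⟩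
  have := isIso_of_mono_of_epi σ
  exact ⟨(asIso σ).symm⟩

end Simple

end CategoryTheory.AdditiveFunctor

end AdditiveFunctorElements

/-! ### Chain conditions and finite presentation for functors on a linear category. -/

section LinearFunctors

namespace CategoryTheory.AdditiveFunctor

variable {A : Type w} [Category.{v} A] [Preadditive A] (R : Type*) [CommRing R] [Linear R A]
  {F G H : Aᵒᵖ ⥤+ AddCommGrpCat.{v}} {M : A}

/-- The maps whose image under `p : Hom(-, M) ⟶ F` lies in the range of `τ : G ⟶ F`. -/
def rangeSubmodule (p : additiveYoneda.obj M ⟶ F) (τ : G ⟶ F) (X : A) : Submodule R (X ⟶ M) where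
  carrier := {f | comp p X (toYoneda f) ∈ (comp τ X).range}
  zero_mem' := by
    have : comp p X (toYoneda (0 : X ⟶ M)) = 0 := map_zero (comp p X)
    rw [Set.mem_ofPred_eq, this]
    exact zero_mem _
  add_mem' {f g} hf hg := by
    have : comp p X (toYoneda (f + g)) = comp p X (toYoneda f) + comp p X (toYoneda g) :=
      map_add (comp p X) _ _
    rw [Set.mem_ofPred_eq, this]
    exact add_mem hf hg
  smul_mem' r f hf := by
    obtain ⟨y, hy⟩ := hf
    refine ⟨act G (r • 𝟙 X) y, ?_⟩
    rw [comp_act, hy, ← comp_act, act_toYoneda, Linear.smul_comp, Category.id_comp]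

lemma mem_rangeSubmodule {p : additiveYoneda.obj M ⟶ F} {τ : G ⟶ F} {X : A} {f : X ⟶ M} :
    f ∈ rangeSubmodule R p τ X ↔ comp p X (toYoneda f) ∈ (comp τ X).range :=
  Iff.rfl

lemma mem_rangeSubmodule_zero {p : additiveYoneda.obj M ⟶ F} {X : A} {f : X ⟶ M} :
    f ∈ rangeSubmodule R p (0 : G ⟶ F) X ↔ comp p X (toYoneda f) = 0 :=
  ⟨fun ⟨_, h⟩ => h.symm, fun h => ⟨0, h.symm⟩⟩

/-- Inclusions can be tested on the `X i` because identities are sums of maps through them. Pulling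
back along the epimorphism `p` loses nothing, and gives `R`-modules although the functors take
values in abelian groups. -/
lemma rangeSubmodule_le_iff {ι : Type*} {X : ι → A}
    (hX : ∀ Y : A, 𝟙 Y ∈ AddSubgroup.closure
      {φ | ∃ (i : ι) (a : Y ⟶ X i) (b : X i ⟶ Y), φ = a ≫ b})
    (p : additiveYoneda.obj M ⟶ F) [Epi p] {K L : Subobject F} :
    (∀ i, rangeSubmodule R p K.arrow (X i) ≤ rangeSubmodule R p L.arrow (X i)) ↔ K ≤ L := by
  constructor
  · intro h
    obtain ⟨ρ, hρ⟩ := exists_factor (τ := K.arrow) (σ := L.arrow)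
      (range_le_range_of_generators hX fun i x => by
        obtain ⟨f, hf⟩ := (epi_iff_surjective p).mp inferInstance (X i) (comp K.arrow (X i) x)
        have := h i (x := ofYoneda f) ⟨x, hf.symm⟩
        exact hf ▸ this)
    exact Subobject.le_of_comm ρ hρ
  · rintro h i f ⟨y, hy⟩
    refine ⟨comp (Subobject.ofLE K L h) _ y, ?_⟩
    rw [← comp_comp, Subobject.ofLE_arrow, hy]

/-- If the values of `F` on a finite generating family are Artinian and Noetherian modules, then
`F` is an Artinian and Noetherian object. -/
lemma wellFounded_subobject {ι : Type*} [Finite ι] {X : ι → A}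
    (hX : ∀ Y : A, 𝟙 Y ∈ AddSubgroup.closure
      {φ | ∃ (i : ι) (a : Y ⟶ X i) (b : X i ⟶ Y), φ = a ≫ b})
    (p : additiveYoneda.obj M ⟶ F) [Epi p]
    [∀ i, IsArtinian R ((X i ⟶ M) ⧸ rangeSubmodule R p (0 : F ⟶ F) (X i))]
    [∀ i, IsNoetherian R ((X i ⟶ M) ⧸ rangeSubmodule R p (0 : F ⟶ F) (X i))] :
    WellFoundedLT (Subobject F) ∧ WellFoundedGT (Subobject F) := by
  let Φ : Subobject F ↪o
      ∀ i, Submodule R ((X i ⟶ M) ⧸ rangeSubmodule R p (0 : F ⟶ F) (X i)) :=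
    OrderEmbedding.ofMapLEIff
      (fun K i => (rangeSubmodule R p K.arrow (X i)).map (Submodule.mkQ _)) fun K L => by
        rw [← rangeSubmodule_le_iff R hX p, Pi.le_def]
        refine forall_congr' fun i => ?_
        have h0 : rangeSubmodule R p (0 : F ⟶ F) (X i) ≤ rangeSubmodule R p L.arrow (X i) := by
          intro f hf
          rw [mem_rangeSubmodule_zero] at hf
          rw [mem_rangeSubmodule, hf]
          exact zero_mem _
        rw [Submodule.map_le_iff_le_comap, Submodule.comap_map_mkQ, sup_eq_right.mpr h0]
  have : WellFoundedGT
      (∀ i, Submodule R ((X i ⟶ M) ⧸ rangeSubmodule R p (0 : F ⟶ F) (X i))) :=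
    inferInstanceAs (WellFoundedLT
      (∀ i, (Submodule R ((X i ⟶ M) ⧸ rangeSubmodule R p (0 : F ⟶ F) (X i)))ᵒᵈ))
  exact ⟨Φ.wellFoundedLT, Φ.wellFoundedGT⟩

/-- Finitely many elements are multiples of a single one. -/
lemma exists_common_multiple [HasBinaryBiproducts A] [Nonempty A] {ι : Type*} (X : ι → A)
    (l : List (Σ i, G.obj.obj (op (X i)))) :
    ∃ (P : A) (g : G.obj.obj (op P)), ∀ t ∈ l, ∃ u : X t.1 ⟶ P, act G u g = t.2 := by
  induction l with
  | nil => exact ⟨Classical.arbitrary A, 0, by simp⟩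
  | cons t l ih =>
    obtain ⟨P, g, hg⟩ := ih
    refine ⟨X t.1 ⊞ P, act G biprod.fst t.2 + act G biprod.snd g, fun s hs => ?_⟩
    rcases List.mem_cons.mp hs with rfl | hs
    · exact ⟨biprod.inl, by rw [map_add, ← act_comp, ← act_comp]; simp⟩
    · obtain ⟨u, hu⟩ := hg s hs
      refine ⟨u ≫ biprod.inr, ?_⟩
      rw [map_add, ← act_comp, ← act_comp]
      simp [hu]

/-- Subfunctors of finitely generated functors are finitely generated. -/
lemma exists_epi_of_mono [HasBinaryBiproducts A] [Nonempty A] [IsNoetherianRing R]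
    [∀ X Y : A, Module.Finite R (X ⟶ Y)] {ι : Type*} [Finite ι] {X : ι → A}
    (hX : ∀ Y : A, 𝟙 Y ∈ AddSubgroup.closure
      {φ | ∃ (i : ι) (a : Y ⟶ X i) (b : X i ⟶ Y), φ = a ≫ b})
    (p : additiveYoneda.obj M ⟶ F) [Epi p] (τ : G ⟶ F) [Mono τ] :
    ∃ (P : A) (q : additiveYoneda.obj P ⟶ G), Epi q := by
  classical
  have hinj := (mono_iff_injective τ).mp inferInstance
  -- The preimage of `G` in `Hom(X i, M)` is finitely generated over `R`. Lifting finitely many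
  -- generators for each `i` to `G` and collecting them into one element over a biproduct gives the
  -- covering representable.
  choose S hS using fun i => IsNoetherian.noetherian (rangeSubmodule R p τ (X i))
  have hSmem (i : ι) (f : S i) : ∃ y, comp τ (X i) y = comp p (X i) (toYoneda f.1) :=
    (mem_rangeSubmodule R).mp (hS i ▸ Submodule.subset_span f.2)
  choose y hy using hSmem
  have := Fintype.ofFinite ι
  let l : List (Σ i, G.obj.obj (op (X i))) :=
    (Finset.univ : Finset (Σ i, S i)).toList.map fun t => ⟨t.1, y t.1 t.2⟩
  obtain ⟨P, g, hg⟩ := exists_common_multiple X l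
  refine ⟨P, yonedaHom g, (epi_iff_surjective _).mpr fun Y z => ?_⟩
  have key := range_le_range_of_generators hX (τ := 𝟙 G) (σ := yonedaHom g) ?_ Y z
  · exact key
  intro i x
  rw [comp_id]
  obtain ⟨f, hf⟩ := (epi_iff_surjective p).mp inferInstance (X i) (comp τ (X i) x)
  obtain ⟨f, rfl⟩ : ∃ f' : X i ⟶ M, toYoneda f' = f := ⟨ofYoneda f, rfl⟩
  have hfS : f ∈ Submodule.span R (S i : Set (X i ⟶ M)) := by
    rw [hS i]
    exact ⟨x, hf.symm⟩
  suffices h : ∀ f ∈ Submodule.span R (S i : Set (X i ⟶ M)),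
      ∃ u : X i ⟶ P, comp τ (X i) (act G u g) = comp p (X i) (toYoneda f) by
    obtain ⟨u, hu⟩ := h f hfS
    exact ⟨toYoneda u, hinj _ (by rw [comp_yonedaHom, hu, hf])⟩
  intro f hf
  induction hf using Submodule.span_induction with
  | mem f hf =>
    obtain ⟨u, hu⟩ := hg ⟨i, y i ⟨f, hf⟩⟩ (List.mem_map.mpr ⟨⟨i, ⟨f, hf⟩⟩, by simp, rfl⟩)
    exact ⟨u, by rw [hu, hy]⟩
  | zero => exact ⟨0, by rw [act_zero, map_zero]; exact (map_zero (comp p (X i))).symm⟩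
  | add f f' _ _ h h' =>
    obtain ⟨u, hu⟩ := h
    obtain ⟨u', hu'⟩ := h'
    refine ⟨u + u', ?_⟩
    rw [act_add, map_add, hu, hu']
    exact (map_add (comp p (X i)) _ _).symm
  | smul r f _ h =>
    obtain ⟨u, hu⟩ := h
    refine ⟨(r • 𝟙 _) ≫ u, ?_⟩
    rw [act_comp, comp_act, hu, ← comp_act, act_toYoneda, Linear.smul_comp, Category.id_comp]

/-- Subfunctors of finitely generated functors are finitely presented. -/
lemma isFinPresFunctor_of_mono [HasBinaryBiproducts A] [Nonempty A] [IsNoetherianRing R]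
    [∀ X Y : A, Module.Finite R (X ⟶ Y)] {ι : Type*} [Finite ι] {X : ι → A}
    (hX : ∀ Y : A, 𝟙 Y ∈ AddSubgroup.closure
      {φ | ∃ (i : ι) (a : Y ⟶ X i) (b : X i ⟶ Y), φ = a ≫ b})
    (p : additiveYoneda.obj M ⟶ F) [Epi p] (τ : G ⟶ F) [Mono τ] : IsFinPresFunctor G := by
  obtain ⟨P, q, hq⟩ := exists_epi_of_mono R hX p τ
  -- The kernel of the cover is a subfunctor of a representable, so the same result covers it.
  obtain ⟨P', q', hq'⟩ := exists_epi_of_mono R hX (𝟙 (additiveYoneda.obj P)) (kernel.ι q)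
  refine ⟨P', P, q' ≫ kernel.ι q, q, by simp, ?_, hq⟩
  rw [ShortComplex.exact_iff_epi_kernel_lift]
  have h : kernel.lift q (q' ≫ kernel.ι q) (by simp) = q' := by
    rw [← cancel_mono (kernel.ι q), kernel.lift_ι]
  rw [← h] at hq'
  exact hq'

end CategoryTheory.AdditiveFunctor

end LinearFunctors

/-! ### The category of MCM modules, and the filtration. -/

section MCMCategory

variable {R : Type u} [CommRing R] [IsLocalRing R]

instance : HasBinaryBiproducts (MCMCat R) where
  has_binary_biproduct M N := by
    let b : BinaryBicone M N :=
      { pt := ⟨ModuleCat.of R (M.obj × N.obj), M.property.prod N.property⟩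
        fst := ObjectProperty.homMk (ModuleCat.ofHom (LinearMap.fst R M.obj N.obj))
        snd := ObjectProperty.homMk (ModuleCat.ofHom (LinearMap.snd R M.obj N.obj))
        inl := ObjectProperty.homMk (ModuleCat.ofHom (LinearMap.inl R M.obj N.obj))
        inr := ObjectProperty.homMk (ModuleCat.ofHom (LinearMap.inr R M.obj N.obj))
        inl_fst := by ext; rfl
        inl_snd := by ext; rfl
        inr_fst := by ext; rfl
        inr_snd := by ext; rfl }
    refine hasBinaryBiproduct_of_total b ?_
    refine ObjectProperty.hom_ext _ (ModuleCat.hom_ext (LinearMap.ext fun x => ?_))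
    exact Prod.ext (add_zero x.1) (zero_add x.2)

/-- Maps of maximal Cohen-Macaulay modules are linear maps. -/
noncomputable def MCMCat.homLinearEquiv (M N : MCMCat R) : (M ⟶ N) ≃ₗ[R] (M.obj →ₗ[R] N.obj) where
  toFun f := f.hom.hom
  invFun f := ObjectProperty.homMk (ModuleCat.ofHom f)
  map_add' _ _ := rfl
  map_smul' _ _ := rfl
  left_inv _ := rfl
  right_inv _ := rfl

instance [IsNoetherianRing R] (M N : MCMCat R) : Module.Finite R (M ⟶ N) := by
  have := M.property.1
  have := N.property.1
  exact Module.Finite.equiv (MCMCat.homLinearEquiv M N).symm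

variable (R) in
/-- A ring of finite Cohen-Macaulay type has finitely many indecomposable maximal Cohen-Macaulay
modules up to isomorphism. -/
lemma IsFiniteCMType.exists_family (h : IsFiniteCMType R) :
    ∃ (ι : Type (u + 1)) (_ : Finite ι) (X : ι → MCMCat R), (∀ i, Indecomposable (X i).obj) ∧
      ∀ M, isMCM R M → Indecomposable M → ∃ i, Nonempty (M ≅ (X i).obj) := by
  refine ⟨{c : Quotient (isIsomorphicSetoid (MCMCat R)) |
    ∃ M : MCMCat R, Indecomposable M.obj ∧ Quotient.mk _ M = c}, h.to_subtype,
    fun c => c.2.choose, fun c => c.2.choose_spec.1, fun M hM hi => ?_⟩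
  let c : {c : Quotient (isIsomorphicSetoid (MCMCat R)) |
    ∃ M : MCMCat R, Indecomposable M.obj ∧ Quotient.mk _ M = c} :=
    ⟨Quotient.mk _ ⟨M, hM⟩, ⟨M, hM⟩, hi, rfl⟩
  obtain ⟨e⟩ := Quotient.exact c.2.choose_spec.2
  exact ⟨c, ⟨(isMCM R).ι.mapIso e.symm⟩⟩

lemma MCMCat.id_mem_closure {ι : Type*} {X : ι → MCMCat R}
    (hX : ∀ M, isMCM R M → Indecomposable M → ∃ i, Nonempty (M ≅ (X i).obj)) (M : MCMCat R) :
    𝟙 M ∈ AddSubgroup.closure {φ | ∃ (i : ι) (a : M ⟶ X i) (b : X i ⟶ M), φ = a ≫ b} := by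
  have h := M.property.id_mem_closure hX
  let f : (M.obj ⟶ M.obj) →+ (M ⟶ M) := AddMonoidHom.mk' ObjectProperty.homMk fun _ _ => rfl
  have hle : AddSubgroup.closure
      {φ | ∃ (i : ι) (a : M.obj ⟶ (X i).obj) (b : (X i).obj ⟶ M.obj), φ = a ≫ b} ≤
      (AddSubgroup.closure {φ | ∃ (i : ι) (a : M ⟶ X i) (b : X i ⟶ M), φ = a ≫ b}).comap f := by
    rw [AddSubgroup.closure_le]
    rintro _ ⟨i, a, b, rfl⟩
    exact AddSubgroup.subset_closure ⟨i, ObjectProperty.homMk a, ObjectProperty.homMk b, rfl⟩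
  exact hle h

open CategoryTheory.AdditiveFunctor

/-- If `F` is the cokernel of `Hom(-, γ)` and `F(R) = 0`, then `γ` is surjective. -/
lemma MCMCat.surjective_of_isZero [IsNoetherianRing R] [IsCMLocalRing R] {F : MCMFunctor R}
    {M₁ M₀ : MCMCat R} {g : additiveYoneda.obj M₁ ⟶ additiveYoneda.obj M₀}
    {p : additiveYoneda.obj M₀ ⟶ F} {w : g ≫ p = 0} (hex : (ShortComplex.mk g p w).Exact)
    (hF : IsZero (F.obj.obj (op (MCMCat.self R)))) (γ : M₁ ⟶ M₀)
    (hγ : g = additiveYoneda.map γ) : Function.Surjective γ.hom.hom := by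
  intro x
  let f : MCMCat.self R ⟶ M₀ := ObjectProperty.homMk
    (ModuleCat.ofHom (LinearMap.toSpanSingleton R M₀.obj x))
  have := AddCommGrpCat.subsingleton_of_isZero hF
  obtain ⟨y, hy⟩ := exists_comp_eq_of_exact hex (toYoneda f) (Subsingleton.elim _ _)
  subst hγ
  have h : ofYoneda y ≫ γ = f := hy
  refine ⟨(ofYoneda y).hom.hom (1 : R), ?_⟩
  have h1 := congr(($h).hom.hom (1 : R))
  exact h1.trans (one_smul R x)

/-- Over a Henselian ring of finite Cohen-Macaulay type, finitely presented functors vanishing on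
`R` have finite filtrations with simple factors `S_M`. -/
theorem IsFiniteCMType.exists_filtration {R : Type u} [CommRing R] [HenselianLocalRing R]
    [IsNoetherianRing R] [IsCMLocalRing R] (hfin : IsFiniteCMType R) {F : MCMFunctor R} (hF : IsFinPresVanishing F) :
    ∃ (n : ℕ) (s : Fin (n + 1) → Subobject F),
      s 0 = ⊥ ∧ s (Fin.last n) = ⊤ ∧
      (∀ i : Fin (n + 1), IsFinPresVanishing (s i : MCMFunctor R)) ∧
      ∀ i : Fin n, ∃ h : s i.castSucc ≤ s i.succ,
        Simple (cokernel (Subobject.ofLE _ _ h)) ∧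
        ∃ M : MCMCat R, Indecomposable M.obj ∧ ¬ Nonempty (M ≅ MCMCat.self R) ∧
          Nonempty (cokernel (Subobject.ofLE _ _ h) ≅ simpleFunctor M) := by
  obtain ⟨⟨M₁, M₀, g, p, w, hex, hp⟩, hR⟩ := hF
  obtain ⟨ι, _, X, hXi, hX⟩ := hfin.exists_family
  have hgen := MCMCat.id_mem_closure hX
  have hself := AddCommGrpCat.subsingleton_of_isZero hR
  have : Nonempty (MCMCat R) := ⟨MCMCat.self R⟩
  let γ : M₁ ⟶ M₀ := ofYoneda (AdditiveFunctor.comp g M₁ (toYoneda (𝟙 M₁)))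
  have hgγ : g = additiveYoneda.map γ := AdditiveFunctor.hom_ext fun Y f => by
    have := comp_act g (ofYoneda f) (toYoneda (𝟙 M₁))
    rwa [act_toYoneda, Category.comp_id] at this
  have hγ := MCMCat.surjective_of_isZero hex hR γ hgγ
  -- This quotient is `F(Y)`: some power of each nonunit `r` makes `f` factor through `γ`, and so
  -- kills its class.
  have hart (Y : MCMCat R) : IsArtinian R ((Y ⟶ M₀) ⧸ rangeSubmodule R p (0 : F ⟶ F) Y) := by
    refine isArtinian_of_forall_exists_pow_smul_eq_zero fun r hr f => ?_
    obtain ⟨f, rfl⟩ := Submodule.Quotient.mk_surjective _ f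
    obtain ⟨n, h, hn⟩ := isMCM.exists_pow_smul_eq_comp hX M₀.property M₁.property Y.property hγ
      f.hom.hom hr
    refine ⟨n, ?_⟩
    rw [← Submodule.Quotient.mk_smul, Submodule.Quotient.mk_eq_zero, mem_rangeSubmodule_zero]
    let h' : Y ⟶ M₁ := ObjectProperty.homMk (ModuleCat.ofHom h)
    have h1 : r ^ n • f = h' ≫ γ := by
      apply (MCMCat.homLinearEquiv Y M₀).injective
      rw [map_smul]
      exact hn
    rw [h1, ← comp_map_toYoneda, ← hgγ, ← comp_comp, w, AdditiveFunctor.comp_zero]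
  obtain ⟨h₁, h₂⟩ := wellFounded_subobject R hgen p
  obtain ⟨a, ha0, n, han, hcov⟩ := exists_covBy_seq_of_wellFoundedLT_wellFoundedGT (Subobject F)
  have hsub (K : Subobject F) : Subsingleton ((K : MCMFunctor R).obj.obj (op (MCMCat.self R))) :=
    ((mono_iff_injective K.arrow).mp inferInstance _).subsingleton
  refine ⟨n, fun i => a i, ha0.eq_bot, han.eq_top, fun i => ⟨isFinPresFunctor_of_mono R hgen p
    (a i).arrow, @AddCommGrpCat.isZero_of_subsingleton _ (hsub _)⟩, fun i => ?_⟩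
  have hc : a (i.castSucc : Fin (n + 1)) ⋖ a (i.succ : Fin (n + 1)) := hcov i i.2
  have hs := simple_cokernel_of_covBy hc
  refine ⟨hc.le, hs, ?_⟩
  set Q := cokernel (Subobject.ofLE _ _ hc.le)
  -- A functor vanishing on all the generators `X i` is zero, which a simple one is not.
  obtain ⟨j, q, hq⟩ : ∃ j, ∃ q : Q.obj.obj (op (X j)), q ≠ 0 := by
    by_contra! h0
    refine Simple.not_isZero Q ((IsZero.iff_id_eq_zero _).mpr (AdditiveFunctor.hom_ext fun Y y => ?_))
    obtain ⟨z, hz⟩ := range_le_range_of_generators hgen (τ := 𝟙 Q) (σ := (0 : Q ⟶ Q))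
      (fun i x => ⟨0, by rw [h0 i x, map_zero, map_zero]⟩) Y y
    exact hz.symm
  refine ⟨X j, hXi j, ?_, nonempty_iso_simpleFunctor
    (fun φ => MCMCat.isUnit_or_isUnit_one_sub (hXi j) φ) hq⟩
  rintro ⟨e⟩
  -- `Q` is a quotient of a subfunctor of `F`, so it vanishes at `R`, whereas it is nonzero at `X
  -- j`.
  have hQ : Subsingleton (Q.obj.obj (op (MCMCat.self R))) := by
    have := hsub (a (i.succ : Fin (n + 1)))
    exact ((epi_iff_surjective (cokernel.π (Subobject.ofLE _ _ hc.le))).mp inferInstance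
      _).subsingleton
  apply hq
  rw [← act_id q, ← e.hom_inv_id, act_comp, Subsingleton.elim (act Q e.inv q) 0, map_zero]

end MCMCategory

theorem mainTheorem5 (R : Type u) [CommRing R] [HenselianLocalRing R] [IsNoetherianRing R]
    [IsCMLocalRing R] (hcan : HasCanonicalModule R) (hsing : IsIsolatedSingularity R)
    (hfin : IsFiniteCMType R) (F : MCMFunctor R) (hF : IsFinPresVanishing F) :
    ∃ (n : ℕ) (s : Fin (n + 1) → Subobject F),
      s 0 = ⊥ ∧ s (Fin.last n) = ⊤ ∧
      (∀ i : Fin (n + 1), IsFinPresVanishing (s i : MCMFunctor R)) ∧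
      ∀ i : Fin n, ∃ h : s i.castSucc ≤ s i.succ,
        Simple (cokernel (Subobject.ofLE _ _ h)) ∧
        ∃ M : MCMCat R, Indecomposable M.obj ∧ ¬ Nonempty (M ≅ MCMCat.self R) ∧
          Nonempty (cokernel (Subobject.ofLE _ _ h) ≅ simpleFunctor M) :=
  hfin.exists_filtration hF
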